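/- Let $n,m\ge 0$, $A\in\mathbb R^{n\times n}$, $B\in\mathbb R^{n\times m}$, $\overline w\ge 0$, $\mathcal W=\{w\in\mathbb R^n:\|w\|_\infty\le\overline w\}$, and consider $x_{t+1}=Ax_t+Bu_t+w_t$, $x_0=0$, $w_t\in\mathcal W$ (with $w_t:=0$ for $t<0$). Let $\mathcal X\subseteq\mathbb R^n$ and $\mathcal U\subseteq\mathbb R^m$ be closed convex sets containing the origin. For $\Delta\ge 0$ write $\mathcal D_\Delta=\{x\in\mathcal D: x+y\in\mathcal D\ \forall\,\|y\|_\infty\le\Delta\}$. For matrices $\|\cdot\|_2$ is the spectral norm. Fix $\kappa>1$, $\gamma\in(0,1]$. A matrix $K\in\mathbb R^{m\times n}$ is $(\kappa,\gamma)$-strongly stable if $A-BK=PLP^{-1}$ for some real matrices $L,P$ with $\|L\|_2\le 1-\gamma$ and $\max\{\|K\|_2,\|P\|_2,\|P^{-1}\|_2\}\le\kappa$. Put $\kappa_B=\max\{\|B\|_2,1\}$ and $a=2\kappa^3$. Assume that, for some $\epsilon_*>0$, there is a $(\kappa,\gamma)$-strongly stable $K_{ss}$ such that the linear controller $u_t=-K_{ss}x_t$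 satisfies $x_t\in\mathcal X_{\epsilon_*}$, $u_t\in\mathcal U_{\epsilon_*}$ for all $t\ge 0$ and all disturbance sequences in $\mathcal W$. Assume that the costs $c_t:\mathbb R^n\times\mathbb R^m\to\mathbb R$, $0\le t\le T$, are convex and differentiable and that, for a constant $G$ and every $D>0$, $\|\nabla_x c_t(x,u)\|_2\le GD$ and $\|\nabla_u c_t(x,u)\|_2\le GD$ whenever $\|x\|_2,\|u\|_2\le D$. Let $K$ be a $(\kappa,\gamma)$-strongly stable matrix, $A_K=A-BK$, and let $H\ge 1$ be an integer. For $M=(M^{[1]},\dots,M^{[H]})$, $M^{[i]}\in\mathbb R^{m\times n}$, and $1\le k\le 2H$, let $$\mathring\Psi^x_k(M)=A_K^{k-1}\mathbf 1_{(k\le H)}+\sum_{i=1}^H A_K^{i-1}BM^{[k-i]}\mathbf 1_{(1\le k-i\le H)},\qquad \mathring\Psi^u_k(M)=M^{[k]}\mathbf 1_{(k\le H)}-K\mathring\Psi^x_k(M),$$ $$\mathring h^x(M)=[\mathring\Psi^x_1(M)\ \cdots\ \mathring\Psi^x_{2H}(M)],\qquad \mathring h^u(M)=[\mathring\Psi^u_1(M)\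 \cdots\ \mathring\Psi^u_{2H}(M)].$$ With $\bar{\mathcal B}(\overline w)=\{v\in\mathbb R^{2Hn}:\|v\|_\infty\le\overline w\}$, the safe policy set $\Omega^\epsilon$ consists of all $M$ such that $\|M^{[i]}\|_2\le a(1-\gamma)^{i-1}$ for $1\le i\le H$, $\mathring h^x(M)\bar{\mathcal B}(\overline w)\subseteq\mathcal X_\epsilon$ and $\mathring h^u(M)\bar{\mathcal B}(\overline w)\subseteq\mathcal U_\epsilon$. The algorithm OGD-BZC with memory size $H$, buffer size $\epsilon\ge 0$ and stepsize $\eta\ge 0$ starts from an arbitrary $M_0\in\Omega^\epsilon$; at each time $t$ it applies $u_t=-Kx_t+\sum_{i=1}^H M_t^{[i]}w_{t-i}$, and then sets $M_{t+1}=\Pi_{\Omega^\epsilon}[M_t-\eta\nabla\mathring f_t(M_t)]$. Here $\mathring f_t(M)=c_t\big(\sum_{k=1}^{2H}\mathring\Psi^x_k(M)w_{t-k},\ \sum_{k=1}^{2H}\mathring\Psi^u_k(M)w_{t-k}\big)$, and gradient and projection are taken with respect to the Frobenius norm. **Theorem.** Let $\epsilon\ge 0$ and $H\ge\frac{\log(2\kappa^2)}{\log((1-\gamma)^{-1})}$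 (for $\gamma=1$ the right-hand side is read as $0$), and let $$\epsilon_1(H)=c_1\sqrt n\,H(1-\gamma)^H,\qquad \epsilon_2(\eta,H)=c_2\sqrt{mn^3}\,\eta H^2,\qquad \epsilon_3(H)=c_3\sqrt n\,(1-\gamma)^H,$$ where $c_1=\overline w\kappa^3(2\kappa^3+2a\kappa^3\kappa_B+a)/\gamma$, $c_2=4G\overline w^3(\kappa^3+2a\kappa^3\kappa_B)(1+\kappa)\kappa^5\kappa_B^2/\gamma^4$ and $c_3=2\overline w\kappa^5$. If $$\epsilon_1(H)+\epsilon_2(\eta,H)\le\epsilon\le\epsilon_*-\epsilon_1(H)-\epsilon_3(H),$$ then $\Omega^\epsilon$ is nonempty. Moreover, for every $M_0\in\Omega^\epsilon$ and every disturbance sequence in $\mathcal W$, OGD-BZC satisfies $x_t\in\mathcal X$ and $u_t\in\mathcal U$ for all $0\le t\le T$. -/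

import Mathlib

noncomputable section

namespace OGDBZC

/-! Vectors live in Euclidean spaces, so `‖x‖` is the 2-norm of a vector; conditions on the
infinity norm are written coordinatewise.  Time and lags are natural numbers. -/

section Norms
open scoped Matrix.Norms.L2Operator

/-- The spectral norm (operator 2-norm) of a real matrix. -/
def specNorm {p q : ℕ} (M : Matrix (Fin p) (Fin q) ℝ) : ℝ := ‖M‖

end Norms

/-- The matrix-vector product on Euclidean spaces. -/
def act {ι ι' : Type} [Fintype ι] [Fintype ι'] [DecidableEq ι'] (M : Matrix ι ι' ℝ)
    (v : EuclideanSpace ℝ ι') : EuclideanSpace ℝ ι :=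
  Matrix.toEuclideanLin M v

/-- The closed infinity-norm ball of radius `r` centered at zero. -/
def supBall (ι : Type) (r : ℝ) : Set (EuclideanSpace ℝ ι) := {v | ∀ i, |v i| ≤ r}

/-- The `Δ`-shrinkage of a set under the infinity norm. -/
def shrink {ι : Type} (S : Set (EuclideanSpace ℝ ι)) (Δ : ℝ) : Set (EuclideanSpace ℝ ι) :=
  {x | x ∈ S ∧ ∀ y ∈ supBall ι Δ, x + y ∈ S}

/-- The linear controller `u = -K x` is `(κ, γ)`-strongly stable for the system `(A, B)`. -/
def IsStronglyStable {n m : ℕ} (A : Matrix (Fin n) (Fin n) ℝ) (B : Matrix (Fin n) (Fin m) ℝ)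
    (κ γ : ℝ) (K : Matrix (Fin m) (Fin n) ℝ) : Prop :=
  ∃ L P : Matrix (Fin n) (Fin n) ℝ, IsUnit P ∧ A - B * K = P * L * P⁻¹ ∧
    specNorm L ≤ 1 - γ ∧ specNorm K ≤ κ ∧ specNorm P ≤ κ ∧ specNorm P⁻¹ ≤ κ

/-- The state at time `t` under the linear controller `u = -K x`, started at `0`. -/
def linState {n m : ℕ} (A : Matrix (Fin n) (Fin n) ℝ) (B : Matrix (Fin n) (Fin m) ℝ)
    (K : Matrix (Fin m) (Fin n) ℝ) (w : ℕ → EuclideanSpace ℝ (Fin n)) :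
    ℕ → EuclideanSpace ℝ (Fin n)
  | 0 => 0
  | t + 1 => act A (linState A B K w t) + act B (-(act K (linState A B K w t))) + w t

/-- The linear controller `u = -K x` is `e`-strictly safe over the infinite horizon. -/
def IsStrictlySafe {n m : ℕ} (A : Matrix (Fin n) (Fin n) ℝ) (B : Matrix (Fin n) (Fin m) ℝ)
    (X : Set (EuclideanSpace ℝ (Fin n))) (U : Set (EuclideanSpace ℝ (Fin m)))
    (wbar e : ℝ) (K : Matrix (Fin m) (Fin n) ℝ) : Prop :=
  ∀ w : ℕ → EuclideanSpace ℝ (Fin n), (∀ k, w k ∈ supBall (Fin n) wbar) →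
    ∀ t, linState A B K w t ∈ shrink X e ∧ -(act K (linState A B K w t)) ∈ shrink U e

/-- Standing assumption on the stage costs `c t x u`, `0 ≤ t ≤ T`: convex, differentiable, and
with both partial gradients of norm at most `G * D` on `‖x‖ ≤ D`, `‖u‖ ≤ D`, for every `D`. -/
structure LossAssumption {n m : ℕ} (T : ℕ) (G : ℝ)
    (c : ℕ → EuclideanSpace ℝ (Fin n) → EuclideanSpace ℝ (Fin m) → ℝ) : Prop where
  convex : ∀ t ≤ T, ConvexOn ℝ Set.univ
    (fun p : EuclideanSpace ℝ (Fin n) × EuclideanSpace ℝ (Fin m) => c t p.1 p.2)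
  differentiable : ∀ t ≤ T, Differentiable ℝ
    (fun p : EuclideanSpace ℝ (Fin n) × EuclideanSpace ℝ (Fin m) => c t p.1 p.2)
  grad_state : ∀ t ≤ T, ∀ D : ℝ, 0 < D → ∀ x u, ‖x‖ ≤ D → ‖u‖ ≤ D →
    ‖gradient (fun x' => c t x' u) x‖ ≤ G * D
  grad_input : ∀ t ≤ T, ∀ D : ℝ, 0 < D → ∀ x u, ‖x‖ ≤ D → ‖u‖ ≤ D →
    ‖gradient (fun u' => c t x u') u‖ ≤ G * D

/-- The space of DAC weights: `H`-tuples of `m × n` matrices.  Its Euclidean norm is the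
Frobenius norm of the tuple. -/
abbrev Weights (H m n : ℕ) : Type := EuclideanSpace ℝ (Fin H × Fin m × Fin n)

/-- The block `M^[i]` for `1 ≤ i ≤ H`, and `0` for every other `i`. -/
def block {H m n : ℕ} (M : Weights H m n) (i : ℕ) : Matrix (Fin m) (Fin n) ℝ :=
  if h : 1 ≤ i ∧ i ≤ H then Matrix.of fun r s => M (⟨i - 1, by omega⟩, r, s) else 0

/-- The set of weights with `‖M^[i]‖₂ ≤ a (1 - γ)^(i-1)` for `1 ≤ i ≤ H`. -/
def weightSet (H m n : ℕ) (a γ : ℝ) : Set (Weights H m n) :=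
  {M | ∀ i, 1 ≤ i → i ≤ H → specNorm (block M i) ≤ a * (1 - γ) ^ (i - 1)}

/-- `w_{t-k}`, with the convention that disturbances at negative times are zero. -/
def past {n : ℕ} (w : ℕ → EuclideanSpace ℝ (Fin n)) (t k : ℕ) : EuclideanSpace ℝ (Fin n) :=
  if k ≤ t then w (t - k) else 0

section Response

variable {H n m : ℕ} (A : Matrix (Fin n) (Fin n) ℝ) (B : Matrix (Fin n) (Fin m) ℝ)
  (K : Matrix (Fin m) (Fin n) ℝ)

/-- The disturbance-to-state matrix `Ψ_k^x` (for `k ≥ 1`) of a family of weights, where `Ms i`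
is the weight in force `i` steps ago.  Since `block M 0 = 0`, the truncated difference `k - i`
is harmless. -/
def PsiX (Ms : ℕ → Weights H m n) (k : ℕ) : Matrix (Fin n) (Fin n) ℝ :=
  (if k ≤ H then (A - B * K) ^ (k - 1) else 0) +
    ∑ i ∈ Finset.Icc 1 H, (A - B * K) ^ (i - 1) * B * block (Ms i) (k - i)

/-- The disturbance-to-input matrix `Ψ_k^u` (for `k ≥ 1`). -/
def PsiU (Ms : ℕ → Weights H m n) (k : ℕ) : Matrix (Fin m) (Fin n) ℝ :=
  block (Ms 0) k - K * PsiX A B K Ms k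

/-- The row of blocks `[Ψ_1^x ... Ψ_{2H}^x]` for a weight held fixed. -/
def hX (M : Weights H m n) : Matrix (Fin n) (Fin (2 * H) × Fin n) ℝ :=
  Matrix.of fun r ks => PsiX A B K (fun _ => M) (ks.1 + 1) r ks.2

/-- The row of blocks `[Ψ_1^u ... Ψ_{2H}^u]` for a weight held fixed. -/
def hU (M : Weights H m n) : Matrix (Fin m) (Fin (2 * H) × Fin n) ℝ :=
  Matrix.of fun r ks => PsiU A B K (fun _ => M) (ks.1 + 1) r ks.2

/-- The safe policy set `Ω^e`. -/
def Omega (H : ℕ) (X : Set (EuclideanSpace ℝ (Fin n))) (U : Set (EuclideanSpace ℝ (Fin m)))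
    (a γ wbar e : ℝ) : Set (Weights H m n) :=
  {M | M ∈ weightSet H m n a γ ∧
    act (hX A B K M) '' supBall (Fin (2 * H) × Fin n) wbar ⊆ shrink X e ∧
    act (hU A B K M) '' supBall (Fin (2 * H) × Fin n) wbar ⊆ shrink U e}

/-- The surrogate state at time `t` when the weight `M` is held fixed. -/
def surrState (w : ℕ → EuclideanSpace ℝ (Fin n)) (t : ℕ) (M : Weights H m n) :
    EuclideanSpace ℝ (Fin n) :=
  ∑ k ∈ Finset.Icc 1 (2 * H), act (PsiX A B K (fun _ => M) k) (past w t k)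

/-- The surrogate input at time `t` when the weight `M` is held fixed. -/
def surrInput (w : ℕ → EuclideanSpace ℝ (Fin n)) (t : ℕ) (M : Weights H m n) :
    EuclideanSpace ℝ (Fin m) :=
  ∑ k ∈ Finset.Icc 1 (2 * H), act (PsiU A B K (fun _ => M) k) (past w t k)

/-- The approximate cost at time `t` as a function of the weight. -/
def approxCost (c : ℕ → EuclideanSpace ℝ (Fin n) → EuclideanSpace ℝ (Fin m) → ℝ)
    (w : ℕ → EuclideanSpace ℝ (Fin n)) (t : ℕ) (M : Weights H m n) : ℝ :=
  c t (surrState A B K w t M) (surrInput A B K w t M)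

/-- The disturbance-action input at time `t` in state `x` with weight `M`. -/
def dacInput (w : ℕ → EuclideanSpace ℝ (Fin n)) (t : ℕ) (M : Weights H m n)
    (x : EuclideanSpace ℝ (Fin n)) : EuclideanSpace ℝ (Fin m) :=
  -(act K x) + ∑ i ∈ Finset.Icc 1 H, act (block M i) (past w t i)

end Response

/-- The projection onto `S`: a point of `S` at least distance from `y` (unique when `S` is
closed, convex and nonempty; unspecified if there is no nearest point). -/
def proj {E : Type} [NormedAddCommGroup E] (S : Set E) (y : E) : E :=
  Classical.epsilon fun p => p ∈ S ∧ ∀ q ∈ S, ‖y - p‖ ≤ ‖y - q‖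

section Algorithm

variable {H n m : ℕ} (A : Matrix (Fin n) (Fin n) ℝ) (B : Matrix (Fin n) (Fin m) ℝ)
  (K : Matrix (Fin m) (Fin n) ℝ)
  (c : ℕ → EuclideanSpace ℝ (Fin n) → EuclideanSpace ℝ (Fin m) → ℝ) (η : ℝ)
  (S : Set (Weights H m n)) (M0 : Weights H m n) (w : ℕ → EuclideanSpace ℝ (Fin n))

/-- The weights of OGD-BZC: projected gradient descent on the approximate costs, with policy
set `S`, stepsize `η` and initial weight `M0`. -/
def ogdWeight : ℕ → Weights H m n
  | 0 => M0
  | t + 1 => proj S (ogdWeight t - η • gradient (approxCost A B K c w t) (ogdWeight t))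

/-- The states generated by OGD-BZC from `x_0 = 0`. -/
def ogdState : ℕ → EuclideanSpace ℝ (Fin n)
  | 0 => 0
  | t + 1 => act A (ogdState t) +
      act B (dacInput K w t (ogdWeight A B K c η S M0 w t) (ogdState t)) + w t

/-- The inputs generated by OGD-BZC. -/
def ogdInput (t : ℕ) : EuclideanSpace ℝ (Fin m) :=
  dacInput K w t (ogdWeight A B K c η S M0 w t) (ogdState A B K c η S M0 w t)

end Algorithm

/-- `κ_B = max {‖B‖₂, 1}`. -/
def kappaB {n m : ℕ} (B : Matrix (Fin n) (Fin m) ℝ) : ℝ := max (specNorm B) 1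

/-- The coefficient `a = 2 κ³` in the definition of the weight set. -/
def coefA (κ : ℝ) : ℝ := 2 * κ ^ 3

/-- `ε₁(H) = c₁ √n H (1-γ)^H`, `c₁ = w̄ κ³ (2κ³ + 2aκ³κ_B + a) / γ`. -/
def eps1 (n H : ℕ) (κ κB γ wbar : ℝ) : ℝ :=
  wbar * κ ^ 3 * (2 * κ ^ 3 + 2 * coefA κ * κ ^ 3 * κB + coefA κ) / γ *
    √(n : ℝ) * H * (1 - γ) ^ H

/-- `ε₂(η, H) = c₂ √(m n³) η H²`,
`c₂ = 4 G w̄³ (κ³ + 2aκ³κ_B) (1+κ) κ⁵ κ_B² / γ⁴`. -/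
def eps2 (n m H : ℕ) (κ κB γ wbar G η : ℝ) : ℝ :=
  4 * G * wbar ^ 3 * (κ ^ 3 + 2 * coefA κ * κ ^ 3 * κB) * (1 + κ) * κ ^ 5 * κB ^ 2 / γ ^ 4 *
    √((m : ℝ) * (n : ℝ) ^ 3) * η * (H : ℝ) ^ 2

/-- `ε₃(H) = c₃ √n (1-γ)^H`, `c₃ = 2 w̄ κ⁵`. -/
def eps3 (n H : ℕ) (κ γ wbar : ℝ) : ℝ :=
  2 * wbar * κ ^ 5 * √(n : ℝ) * (1 - γ) ^ H

end OGDBZC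

end

open OGDBZC

/-! Safety follows from comparing the true state $x_t$ with the response that the current weight
$M_t$ would give if held fixed, with the closed-loop memory cut after $H$ steps. Membership of $M_t$
in $\Omega^\epsilon$ means that this response and its input have margin $\epsilon$ for every
admissible history (`mem_Omega_iff`). If $r$ is the difference of the two states, the inputs differ
by $-Kr$, so $\kappa\|r\|_2\le\epsilon$ suffices. Unrolling the closed loop
(`norm_sub_fixedState_le`) splits $r$ in two. The lags beyond $H$ are geometrically small and are
absorbed by $\epsilon_1$. In the lags up to $H$ only the weights differ. Since projection onto a
convex set brings no point of the set farther away, one update moves the weight by at most $\eta$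
times the gradient norm (`norm_gradient_approxCost_le`). The drift therefore grows at most linearly
in the lag, and its effect is absorbed by $\epsilon_2$.

For nonemptiness, write $-K_{ss}x=-Kx+(K-K_{ss})x$ and expand $x$ under the linear policy as $\sum_i
(A-BK_{ss})^{i-1}w_{t-i}$. Keeping $H$ lags gives `linearWeights`. As
$B(K-K_{ss})=(A-BK_{ss})-(A-BK)$, the response matrices telescope: the first $H$ are exactly those
of $K_{ss}$, the last $H$ carry a factor $(1-\gamma)^H$. The margin $\epsilon_*$ thus loses at most
$\epsilon_1$ (`linearWeights_mem_Omega`). -/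

namespace OGDBZC

/-! ### Algebra of the matrix-vector product -/

section MatrixAction

variable {ι ι' ι'' : Type} [Fintype ι] [Fintype ι'] [Fintype ι''] [DecidableEq ι']
  [DecidableEq ι'']

lemma act_apply (M : Matrix ι ι' ℝ) (v : EuclideanSpace ℝ ι') (i : ι) :
    act M v i = ∑ j, M i j * v j := by
  simp [act, Matrix.toLpLin_apply, Matrix.mulVec, dotProduct]

lemma act_add (M : Matrix ι ι' ℝ) (v v' : EuclideanSpace ℝ ι') :
    act M (v + v') = act M v + act M v' := map_add _ _ _

lemma act_sub (M : Matrix ι ι' ℝ) (v v' : EuclideanSpace ℝ ι') :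
    act M (v - v') = act M v - act M v' := map_sub _ _ _

lemma act_neg (M : Matrix ι ι' ℝ) (v : EuclideanSpace ℝ ι') :
    act M (-v) = -act M v := map_neg _ _

lemma act_zero (M : Matrix ι ι' ℝ) : act M 0 = 0 := map_zero _

lemma act_sum {α : Type} (M : Matrix ι ι' ℝ) (s : Finset α) (f : α → EuclideanSpace ℝ ι') :
    act M (∑ x ∈ s, f x) = ∑ x ∈ s, act M (f x) := map_sum _ _ _

lemma add_act (M N : Matrix ι ι' ℝ) (v : EuclideanSpace ℝ ι') :
    act (M + N) v = act M v + act N v := by simp [act]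

lemma sub_act (M N : Matrix ι ι' ℝ) (v : EuclideanSpace ℝ ι') :
    act (M - N) v = act M v - act N v := by simp [act]

lemma smul_act (r : ℝ) (M : Matrix ι ι' ℝ) (v : EuclideanSpace ℝ ι') :
    act (r • M) v = r • act M v := by simp [act]

lemma zero_act (v : EuclideanSpace ℝ ι') : act (0 : Matrix ι ι' ℝ) v = 0 := by simp [act]

lemma sum_act {α : Type} (s : Finset α) (f : α → Matrix ι ι' ℝ) (v : EuclideanSpace ℝ ι') :
    act (∑ x ∈ s, f x) v = ∑ x ∈ s, act (f x) v := by simp [act]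

lemma one_act (v : EuclideanSpace ℝ ι') : act (1 : Matrix ι' ι' ℝ) v = v := by
  ext i; simp [act_apply, Matrix.one_apply]

lemma mul_act (M : Matrix ι ι' ℝ) (N : Matrix ι' ι'' ℝ) (v : EuclideanSpace ℝ ι'') :
    act (M * N) v = act M (act N v) := by
  simp [act, Matrix.toLpLin_apply, Matrix.mulVec_mulVec]

end MatrixAction

/-! ### Norm bounds and shrunken sets -/

section SpectralNorm

variable {p q : ℕ}

open scoped Matrix.Norms.L2Operator in
lemma specNorm_nonneg (M : Matrix (Fin p) (Fin q) ℝ) : 0 ≤ specNorm M := norm_nonneg M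

lemma norm_act_le (M : Matrix (Fin p) (Fin q) ℝ) (v : EuclideanSpace ℝ (Fin q)) :
    ‖act M v‖ ≤ specNorm M * ‖v‖ := by
  simpa [act, specNorm, Matrix.toLpLin_apply] using Matrix.l2_opNorm_mulVec M v

lemma specNorm_le_iff (M : Matrix (Fin p) (Fin q) ℝ) {r : ℝ} (hr : 0 ≤ r) :
    specNorm M ≤ r ↔ ∀ v, ‖act M v‖ ≤ r * ‖v‖ := by
  refine ⟨fun h v => (norm_act_le M v).trans (by gcongr), fun h => ?_⟩
  rw [specNorm, Matrix.l2_opNorm_def]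
  exact ContinuousLinearMap.opNorm_le_bound _ hr h

lemma norm_act_le_of_le {M : Matrix (Fin p) (Fin q) ℝ} {v : EuclideanSpace ℝ (Fin q)} {r s : ℝ}
    (hM : specNorm M ≤ r) (hv : ‖v‖ ≤ s) : ‖act M v‖ ≤ r * s :=
  (norm_act_le M v).trans
    (mul_le_mul hM hv (norm_nonneg _) ((specNorm_nonneg M).trans hM))

lemma norm_le_of_mem_supBall {r : ℝ} (hr : 0 ≤ r) {v : EuclideanSpace ℝ (Fin p)}
    (hv : v ∈ supBall (Fin p) r) : ‖v‖ ≤ √(p : ℝ) * r := by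
  rw [EuclideanSpace.norm_eq, ← Real.sqrt_sq hr, ← Real.sqrt_mul (by positivity)]
  refine Real.sqrt_le_sqrt ?_
  calc ∑ i, ‖v i‖ ^ 2 ≤ ∑ _i : Fin p, r ^ 2 :=
        Finset.sum_le_sum fun i _ => pow_le_pow_left₀ (norm_nonneg _) (hv i) 2
    _ = p * r ^ 2 := by simp

lemma mem_supBall_of_norm_le {r : ℝ} {v : EuclideanSpace ℝ (Fin p)} (hv : ‖v‖ ≤ r) :
    v ∈ supBall (Fin p) r := fun i => (PiLp.norm_apply_le v i).trans hv

lemma zero_mem_supBall {ι : Type} {r : ℝ} (hr : 0 ≤ r) : (0 : EuclideanSpace ℝ ι) ∈ supBall ι r :=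
  fun i => by simpa using hr

/-- The sup norm is at most the 2-norm, so the perturbation `e` consumes at most `δ` of the margin
`r`. -/
lemma add_mem_shrink {S : Set (EuclideanSpace ℝ (Fin p))} {r s δ : ℝ}
    {x e : EuclideanSpace ℝ (Fin p)} (hx : x ∈ shrink S r) (he : ‖e‖ ≤ δ) (hs : 0 ≤ s)
    (h : s + δ ≤ r) : x + e ∈ shrink S s := by
  have key : ∀ y ∈ supBall (Fin p) s, x + e + y ∈ S := by
    intro y hy
    rw [add_assoc]
    refine hx.2 _ fun i => ?_
    have h1 := mem_supBall_of_norm_le he i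
    have h2 := hy i
    have h3 := abs_add_le (e i) (y i)
    simp only [PiLp.add_apply]
    linarith
  exact ⟨by simpa using key 0 (zero_mem_supBall hs), key⟩

lemma convex_shrink {S : Set (EuclideanSpace ℝ (Fin p))} (hS : Convex ℝ S) (r : ℝ) :
    Convex ℝ (shrink S r) := by
  intro x hx y hy a b ha hb hab
  refine ⟨hS hx.1 hy.1 ha hb hab, fun z hz => ?_⟩
  have h := hS (hx.2 z hz) (hy.2 z hz) ha hb hab
  have e : a • (x + z) + b • (y + z) = a • x + b • y + z := by
    rw [smul_add, smul_add, add_add_add_comm, ← add_smul, hab, one_smul]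
  rwa [e] at h

lemma isClosed_shrink {S : Set (EuclideanSpace ℝ (Fin p))} (hS : IsClosed S) (r : ℝ) :
    IsClosed (shrink S r) := by
  have : shrink S r = S ∩ ⋂ y ∈ supBall (Fin p) r, (fun x => x + y) ⁻¹' S := by
    ext x; simp [shrink]
  rw [this]
  exact hS.inter (isClosed_biInter fun y _ => hS.preimage (by fun_prop))

end SpectralNorm

/-! ### Geometric sums -/

section GeometricSums

lemma sum_Icc_one {V : Type} [AddCommMonoid V] (f : ℕ → V) (N : ℕ) :
    ∑ i ∈ Finset.Icc 1 N, f i = ∑ i ∈ Finset.range N, f (i + 1) := by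
  induction N with
  | zero => simp
  | succ N ih => rw [Finset.sum_Icc_succ_top (by omega), Finset.sum_range_succ, ih]

variable {γ : ℝ}

lemma sum_geometric_le (hγ0 : 0 < γ) (hγ1 : γ ≤ 1) (N : ℕ) :
    ∑ s ∈ Finset.range N, (1 - γ) ^ s ≤ 1 / γ := by
  have h := mul_neg_geom_sum (1 - γ) N
  rw [le_div_iff₀ hγ0]
  have h2 : 0 ≤ (1 - γ) ^ N := pow_nonneg (by linarith) N
  linarith

lemma sum_succ_mul_geometric_le (hγ0 : 0 < γ) (hγ1 : γ ≤ 1) (N : ℕ) :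
    ∑ s ∈ Finset.range N, ((s : ℝ) + 1) * (1 - γ) ^ s ≤ 1 / γ ^ 2 := by
  -- An exact closed form, so that induction applies; dropping its negative term gives the bound.
  have h : (∑ s ∈ Finset.range N, ((s : ℝ) + 1) * (1 - γ) ^ s) * γ ^ 2
      = 1 - (1 + N * γ) * (1 - γ) ^ N := by
    induction N with
    | zero => simp
    | succ N ih => rw [Finset.sum_range_succ, add_mul, ih]; push_cast; ring
  rw [le_div_iff₀ (by positivity), h]
  have h2 : 0 ≤ (1 - γ) ^ N := pow_nonneg (by linarith) N
  have : 0 ≤ (1 + N * γ) * (1 - γ) ^ N := by positivity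
  linarith

end GeometricSums

/-! ### Powers of a strongly stable closed loop and forced recursions -/

section Stability

variable {n m : ℕ}

/-- Powers of $PLP^{-1}$ are $PL^kP^{-1}$; the outer factors cost $\kappa^2$ once, whatever `k` is.
-/
lemma IsStronglyStable.norm_pow_act_le {A : Matrix (Fin n) (Fin n) ℝ}
    {B : Matrix (Fin n) (Fin m) ℝ} {κ γ : ℝ} {K : Matrix (Fin m) (Fin n) ℝ}
    (hγ1 : γ ≤ 1) (h : IsStronglyStable A B κ γ K) (k : ℕ) (v : EuclideanSpace ℝ (Fin n)) :
    ‖act ((A - B * K) ^ k) v‖ ≤ κ ^ 2 * (1 - γ) ^ k * ‖v‖ := by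
  obtain ⟨L, P, hP, hQ, hL, -, hPn, hPi⟩ := h
  have hPP : P⁻¹ * P = 1 := Matrix.nonsing_inv_mul P ((Matrix.isUnit_iff_isUnit_det P).1 hP)
  have hPP' : P * P⁻¹ = 1 := Matrix.mul_nonsing_inv P ((Matrix.isUnit_iff_isUnit_det P).1 hP)
  have hpow : (A - B * K) ^ k = P * L ^ k * P⁻¹ := by
    rw [hQ]
    induction k with
    | zero => simp [hPP']
    | succ k ih =>
      rw [pow_succ, ih, pow_succ]
      calc P * L ^ k * P⁻¹ * (P * L * P⁻¹) = P * L ^ k * (P⁻¹ * P) * L * P⁻¹ := by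
            simp only [mul_assoc]
        _ = _ := by rw [hPP]; simp only [mul_assoc, one_mul]
  have hLk : ∀ j u, ‖act (L ^ j) u‖ ≤ (1 - γ) ^ j * ‖u‖ := by
    intro j
    induction j with
    | zero => intro u; simp [one_act]
    | succ j ih =>
      intro u
      rw [pow_succ, mul_act]
      have hq : 0 ≤ 1 - γ := by linarith
      calc _ ≤ (1 - γ) ^ j * ‖act L u‖ := ih _
        _ ≤ (1 - γ) ^ j * ((1 - γ) * ‖u‖) := by
            gcongr
            exact norm_act_le_of_le hL le_rfl
        _ = _ := by ring
  rw [hpow, mul_assoc, mul_act, mul_act]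
  calc _ ≤ κ * ((1 - γ) ^ k * (κ * ‖v‖)) := by
        refine norm_act_le_of_le hPn ((hLk k _).trans ?_)
        have hq : 0 ≤ 1 - γ := by linarith
        gcongr
        exact norm_act_le_of_le hPi le_rfl
    _ = _ := by ring

variable {Q : Matrix (Fin n) (Fin n) ℝ} {κ γ : ℝ}

lemma norm_sum_pow_act_le (hγ0 : 0 < γ) (hγ1 : γ ≤ 1)
    (hQ : ∀ k v, ‖act (Q ^ k) v‖ ≤ κ ^ 2 * (1 - γ) ^ k * ‖v‖)
    {C : ℝ} (hC : 0 ≤ C) {y : ℕ → EuclideanSpace ℝ (Fin n)} (hy : ∀ s, ‖y s‖ ≤ C) (j N : ℕ) :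
    ‖∑ s ∈ Finset.range N, act (Q ^ (j + s)) (y s)‖ ≤ κ ^ 2 * (1 - γ) ^ j * C / γ := by
  have hq : 0 ≤ 1 - γ := by linarith
  calc _ ≤ ∑ s ∈ Finset.range N, κ ^ 2 * (1 - γ) ^ j * C * (1 - γ) ^ s := by
        refine norm_sum_le_of_le _ fun s _ => (hQ _ _).trans ?_
        calc _ ≤ κ ^ 2 * (1 - γ) ^ (j + s) * C := by gcongr; exact hy s
          _ = _ := by ring
    _ = κ ^ 2 * (1 - γ) ^ j * C * ∑ s ∈ Finset.range N, (1 - γ) ^ s := by rw [Finset.mul_sum]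
    _ ≤ κ ^ 2 * (1 - γ) ^ j * C * (1 / γ) := by
        gcongr
        exact sum_geometric_le hγ0 hγ1 N
    _ = _ := by ring

/-- Meant for inputs caused by weight drift, which grows with the lag; the linear growth costs a
second factor $1/\gamma$. -/
lemma norm_sum_pow_act_le_of_linear (hγ0 : 0 < γ) (hγ1 : γ ≤ 1)
    (hQ : ∀ k v, ‖act (Q ^ k) v‖ ≤ κ ^ 2 * (1 - γ) ^ k * ‖v‖)
    {C : ℝ} (hC : 0 ≤ C) {y : ℕ → EuclideanSpace ℝ (Fin n)}
    (hy : ∀ s, ‖y s‖ ≤ C * ((s : ℝ) + 1)) (N : ℕ) :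
    ‖∑ s ∈ Finset.range N, act (Q ^ s) (y s)‖ ≤ κ ^ 2 * C / γ ^ 2 := by
  have hq : 0 ≤ 1 - γ := by linarith
  calc _ ≤ ∑ s ∈ Finset.range N, κ ^ 2 * C * (((s : ℝ) + 1) * (1 - γ) ^ s) := by
        refine norm_sum_le_of_le _ fun s _ => (hQ _ _).trans ?_
        calc _ ≤ κ ^ 2 * (1 - γ) ^ s * (C * ((s : ℝ) + 1)) := by gcongr; exact hy s
          _ = _ := by ring
    _ = κ ^ 2 * C * ∑ s ∈ Finset.range N, ((s : ℝ) + 1) * (1 - γ) ^ s := by rw [Finset.mul_sum]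
    _ ≤ κ ^ 2 * C * (1 / γ ^ 2) := by
        gcongr
        exact sum_succ_mul_geometric_le hγ0 hγ1 N
    _ = _ := by ring

/-- The solution of a forced linear recursion started at zero. -/
lemma recursion_eq_sum {x d : ℕ → EuclideanSpace ℝ (Fin n)} (h0 : x 0 = 0)
    (hx : ∀ t, x (t + 1) = act Q (x t) + d t) (t N : ℕ) (hN : t ≤ N) :
    x t = ∑ s ∈ Finset.range N, act (Q ^ s) (past d t (s + 1)) := by
  induction t generalizing N with
  | zero =>
    rw [h0]
    exact (Finset.sum_eq_zero fun s _ => by simp [past, act_zero]).symm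
  | succ t ih =>
    obtain ⟨N, rfl⟩ : ∃ N', N = N' + 1 := ⟨N - 1, by omega⟩
    rw [Finset.sum_range_succ', hx, ih N (by omega), act_sum]
    congr 1
    · refine Finset.sum_congr rfl fun s _ => ?_
      rw [pow_succ', mul_act]
      simp [past]
    · simp [past, one_act]

end Stability

/-! ### Projection onto a closed convex set -/

section Projection

variable {E : Type} [NormedAddCommGroup E] [InnerProductSpace ℝ E] [FiniteDimensional ℝ E]
  {S : Set E}

lemma proj_spec (hS : IsClosed S) (hne : S.Nonempty) (y : E) :
    proj S y ∈ S ∧ ∀ q ∈ S, ‖y - proj S y‖ ≤ ‖y - q‖ := by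
  refine Classical.epsilon_spec (p := fun p => p ∈ S ∧ ∀ q ∈ S, ‖y - p‖ ≤ ‖y - q‖) ?_
  obtain ⟨p, hp, h⟩ := hS.exists_infDist_eq_dist hne y
  refine ⟨p, hp, fun q hq => ?_⟩
  rw [← dist_eq_norm, ← dist_eq_norm, ← h]
  exact Metric.infDist_le_dist_of_mem hq

/-- The vectors from the projection to `y` and to `x` make an angle that is not acute, so expanding
the square of their difference gives the inequality. -/
lemma norm_proj_sub_le (hS : IsClosed S) (hconv : Convex ℝ S) {x : E} (hx : x ∈ S) (y : E) :
    ‖proj S y - x‖ ≤ ‖y - x‖ := by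
  obtain ⟨hp, hmin⟩ := proj_spec hS ⟨x, hx⟩ y
  have : Nonempty S := ⟨⟨x, hx⟩⟩
  have hinf : ‖y - proj S y‖ = ⨅ w : S, ‖y - w‖ :=
    le_antisymm (le_ciInf fun w => hmin _ w.2)
      (ciInf_le ⟨0, by rintro _ ⟨w, rfl⟩; exact norm_nonneg _⟩ (⟨_, hp⟩ : S))
  have hin := (norm_eq_iInf_iff_real_inner_le_zero hconv hp).1 hinf x hx
  have e : y - x = (y - proj S y) - (x - proj S y) := by abel
  have h2 := norm_sub_sq_real (y - proj S y) (x - proj S y)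
  rw [← e] at h2
  rw [norm_sub_rev]
  refine le_of_sq_le_sq ?_ (norm_nonneg _)
  nlinarith [sq_nonneg ‖y - proj S y‖]

end Projection

/-! ### The disturbance-action term as a linear map of the weight -/

section Weights

variable {H n m : ℕ}

lemma block_of_not {M : Weights H m n} {i : ℕ} (h : ¬(1 ≤ i ∧ i ≤ H)) : block M i = 0 :=
  dif_neg h

lemma block_succ (M : Weights H m n) (i : Fin H) (r : Fin m) (s : Fin n) :
    block M (i + 1) r s = M (i, r, s) := by
  have h : 1 ≤ (i : ℕ) + 1 ∧ (i : ℕ) + 1 ≤ H := ⟨by omega, i.2⟩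
  simp [block, h]

lemma block_add (M N : Weights H m n) (i : ℕ) : block (M + N) i = block M i + block N i := by
  unfold block
  split
  · ext r s; simp
  · simp

lemma block_smul (r : ℝ) (M : Weights H m n) (i : ℕ) : block (r • M) i = r • block M i := by
  unfold block
  split
  · ext r s; simp
  · simp

/-- The action of one block of a weight on a fixed vector, as a linear map of the weight. -/
noncomputable def blockAct (i : ℕ) (v : EuclideanSpace ℝ (Fin n)) :
    Weights H m n →ₗ[ℝ] EuclideanSpace ℝ (Fin m) where
  toFun M := act (block M i) v
  map_add' M N := by rw [block_add, add_act]
  map_smul' r M := by rw [block_smul, smul_act]; rfl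

/-- The disturbance-action term `∑ i, M^[i] p_i`, as a linear map of the weight. -/
noncomputable def lagSum (p : ℕ → EuclideanSpace ℝ (Fin n)) :
    Weights H m n →ₗ[ℝ] EuclideanSpace ℝ (Fin m) :=
  ∑ i ∈ Finset.Icc 1 H, blockAct i (p i)

lemma lagSum_apply (p : ℕ → EuclideanSpace ℝ (Fin n)) (M : Weights H m n) :
    lagSum p M = ∑ i ∈ Finset.Icc 1 H, act (block M i) (p i) := by
  simp [lagSum, LinearMap.sum_apply, blockAct]

/-- Cauchy–Schwarz in each output coordinate, over all lags and entries at once, matches the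
Frobenius norm and costs only `√H`. -/
lemma norm_lagSum_le {p : ℕ → EuclideanSpace ℝ (Fin n)} {σ : ℝ} (hσ : 0 ≤ σ)
    (hp : ∀ i, ‖p i‖ ≤ σ) (M : Weights H m n) : ‖lagSum p M‖ ≤ √(H : ℝ) * σ * ‖M‖ := by
  have hcoord : ∀ r, lagSum p M r
      = ∑ x : Fin H × Fin n, M (x.1, r, x.2) * p (x.1 + 1) x.2 := by
    intro r
    rw [lagSum_apply, sum_Icc_one, Finset.sum_range, Fintype.sum_prod_type]
    simp only [WithLp.ofLp_sum, Finset.sum_apply, act_apply, block_succ]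
  have hP : ∑ x : Fin H × Fin n, p (x.1 + 1) x.2 ^ 2 ≤ H * σ ^ 2 := by
    rw [Fintype.sum_prod_type]
    calc _ ≤ ∑ _i : Fin H, σ ^ 2 := Finset.sum_le_sum fun i _ => by
            refine (EuclideanSpace.real_norm_sq_eq (p (i + 1))).symm.trans_le ?_
            exact pow_le_pow_left₀ (norm_nonneg _) (hp _) 2
      _ = _ := by simp
  have hM : ‖M‖ ^ 2 = ∑ r, ∑ x : Fin H × Fin n, M (x.1, r, x.2) ^ 2 := by
    rw [EuclideanSpace.real_norm_sq_eq, Fintype.sum_prod_type]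
    simp only [Fintype.sum_prod_type]
    rw [Finset.sum_comm]
  have h : ‖lagSum p M‖ ^ 2 ≤ (√(H : ℝ) * σ * ‖M‖) ^ 2 := by
    rw [EuclideanSpace.real_norm_sq_eq, mul_pow, mul_pow, Real.sq_sqrt (by positivity), hM,
      Finset.mul_sum]
    refine Finset.sum_le_sum fun r _ => ?_
    rw [hcoord]
    refine (Finset.sum_mul_sq_le_sq_mul_sq _ _ _).trans ?_
    rw [mul_comm]
    gcongr
  exact le_of_sq_le_sq h (by positivity)

/-- A deliberate weakening that supplies the factor `√m` of `eps2`. It is valid even for `m = 0`,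
where the left side vanishes. -/
lemma norm_lagSum_le_sqrt {p : ℕ → EuclideanSpace ℝ (Fin n)} {σ : ℝ} (hσ : 0 ≤ σ)
    (hp : ∀ i, ‖p i‖ ≤ σ) (M : Weights H m n) :
    ‖lagSum p M‖ ≤ √(m : ℝ) * (√(H : ℝ) * σ * ‖M‖) := by
  rcases Nat.eq_zero_or_pos m with rfl | hm
  · simp [Subsingleton.elim (lagSum p M) 0]
  · have h1 : 1 ≤ √(m : ℝ) := Real.one_le_sqrt.2 (by exact_mod_cast hm)
    calc _ ≤ 1 * (√(H : ℝ) * σ * ‖M‖) := by simpa using norm_lagSum_le hσ hp M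
      _ ≤ _ := by gcongr

lemma norm_lagSum_le_of_mem {a γ : ℝ} (ha : 0 ≤ a) (hγ0 : 0 < γ) (hγ1 : γ ≤ 1)
    {p : ℕ → EuclideanSpace ℝ (Fin n)} {σ : ℝ} (hp : ∀ i, ‖p i‖ ≤ σ)
    {M : Weights H m n} (hM : M ∈ weightSet H m n a γ) : ‖lagSum p M‖ ≤ H * (a * σ) := by
  rw [lagSum_apply]
  calc _ ≤ ∑ _i ∈ Finset.Icc 1 H, a * σ := by
        refine norm_sum_le_of_le _ fun i hi => ?_
        rw [Finset.mem_Icc] at hi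
        refine norm_act_le_of_le ((hM i hi.1 hi.2).trans ?_) (hp i)
        exact mul_le_of_le_one_right ha (pow_le_one₀ (by linarith) (by linarith))
    _ = _ := by simp

/-- Testing the spectral norm on each vector exhibits the set as an intersection of linear preimages
of balls, from which closedness and convexity can be read off. -/
lemma weightSet_eq {a γ : ℝ} (ha : 0 ≤ a) (hγ1 : γ ≤ 1) :
    weightSet H m n a γ = ⋂ i ∈ Set.Icc 1 H, ⋂ v : EuclideanSpace ℝ (Fin n),
      (blockAct i v) ⁻¹' Metric.closedBall 0 (a * (1 - γ) ^ (i - 1) * ‖v‖) := by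
  have hq : 0 ≤ 1 - γ := by linarith
  ext M
  simp only [weightSet, Set.mem_ofPred_eq, Set.mem_iInter, Set.mem_Icc, and_imp, Set.mem_preimage,
    mem_closedBall_zero_iff]
  exact forall_congr' fun i => forall_congr' fun _ => forall_congr' fun _ =>
    specNorm_le_iff _ (by positivity)

end Weights

/-! ### Fixed-weight responses and the geometry of the safe policy set -/

section Response

variable {H n m : ℕ} (A : Matrix (Fin n) (Fin n) ℝ) (B : Matrix (Fin n) (Fin m) ℝ)
  (K : Matrix (Fin m) (Fin n) ℝ)

/-- The part of the fixed-weight state response that does not depend on the weight. -/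
noncomputable def stateBase (H : ℕ) (p : ℕ → EuclideanSpace ℝ (Fin n)) : EuclideanSpace ℝ (Fin n) :=
  ∑ s ∈ Finset.range H, act ((A - B * K) ^ s) (p (s + 1))

/-- The part of the fixed-weight state response that is linear in the weight. -/
noncomputable def stateLin (p : ℕ → EuclideanSpace ℝ (Fin n)) :
    Weights H m n →ₗ[ℝ] EuclideanSpace ℝ (Fin n) :=
  ∑ s ∈ Finset.range H,
    Matrix.toEuclideanLin ((A - B * K) ^ s) ∘ₗ Matrix.toEuclideanLin B ∘ₗ
      lagSum fun i => p (s + 1 + i)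

lemma stateLin_apply (p : ℕ → EuclideanSpace ℝ (Fin n)) (M : Weights H m n) :
    stateLin A B K p M = ∑ s ∈ Finset.range H,
      act ((A - B * K) ^ s) (act B (lagSum (fun i => p (s + 1 + i)) M)) := by
  simp [stateLin, LinearMap.sum_apply, act]

/-- The state response to the disturbance history `p` when the weight is held fixed. -/
noncomputable def fixedState (p : ℕ → EuclideanSpace ℝ (Fin n)) (M : Weights H m n) :
    EuclideanSpace ℝ (Fin n) :=
  stateBase A B K H p + stateLin A B K p M

/-- The input response to the disturbance history `p` when the weight is held fixed. -/
noncomputable def fixedInput (p : ℕ → EuclideanSpace ℝ (Fin n)) (M : Weights H m n) :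
    EuclideanSpace ℝ (Fin m) :=
  lagSum p M - act K (fixedState A B K p M)

/-- The substitution `k = i + j` works because blocks vanish outside `1..H`, and `i ≤ H` keeps `i +
j` within the window `2 * H`. -/
lemma sum_act_block_sub (p : ℕ → EuclideanSpace ℝ (Fin n)) (M : Weights H m n) {i : ℕ}
    (hi : i ≤ H) :
    ∑ k ∈ Finset.Icc 1 (2 * H), act (block M (k - i)) (p k) = lagSum (fun j => p (i + j)) M := by
  rw [lagSum_apply]
  symm
  refine Finset.sum_of_injOn (fun j => i + j) (fun _ _ _ _ h => by simpa using h) ?_ ?_ ?_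
  · intro j hj
    simp only [Finset.coe_Icc, Set.mem_Icc] at hj ⊢
    omega
  · intro k hk hk'
    rw [block_of_not, zero_act]
    rintro ⟨h1, h2⟩
    exact hk' ⟨k - i, by simp [h1]; omega, by simp; omega⟩
  · intro j _
    simp

lemma sum_PsiX (p : ℕ → EuclideanSpace ℝ (Fin n)) (M : Weights H m n) :
    ∑ k ∈ Finset.Icc 1 (2 * H), act (PsiX A B K (fun _ => M) k) (p k)
      = fixedState A B K p M := by
  simp only [PsiX, add_act, Finset.sum_add_distrib, fixedState]
  congr 1
  · have h := sum_Icc_one (fun k => act ((A - B * K) ^ (k - 1)) (p k)) H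
    simp only [Nat.add_sub_cancel] at h
    rw [stateBase, ← h]
    symm
    refine Finset.sum_subset_zero_on_sdiff (Finset.Icc_subset_Icc_right (by omega)) ?_ ?_
    · intro k hk
      simp only [Finset.mem_sdiff, Finset.mem_Icc] at hk
      rw [if_neg (by omega), zero_act]
    · intro k hk
      rw [if_pos (Finset.mem_Icc.1 hk).2]
  · simp only [sum_act, mul_act]
    have h := sum_Icc_one (fun s =>
      act ((A - B * K) ^ (s - 1)) (act B (lagSum (fun i => p (s + i)) M))) H
    simp only [Nat.add_sub_cancel] at h
    rw [Finset.sum_comm, stateLin_apply, ← h]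
    refine Finset.sum_congr rfl fun i hi => ?_
    rw [← act_sum, ← act_sum, sum_act_block_sub p M (Finset.mem_Icc.1 hi).2]

lemma sum_PsiU (p : ℕ → EuclideanSpace ℝ (Fin n)) (M : Weights H m n) :
    ∑ k ∈ Finset.Icc 1 (2 * H), act (PsiU A B K (fun _ => M) k) (p k)
      = fixedInput A B K p M := by
  simp only [PsiU, sub_act, Finset.sum_sub_distrib, fixedInput, mul_act]
  rw [← act_sum, sum_PsiX]
  congr 1
  simpa using sum_act_block_sub p M (Nat.zero_le H)

/-- A vector of the big ball is a disturbance history cut into `2 * H` slices. Quantifying over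
infinite histories changes nothing, since the responses see only lags `1..2H`. -/
lemma mem_Omega_iff {X : Set (EuclideanSpace ℝ (Fin n))} {U : Set (EuclideanSpace ℝ (Fin m))}
    {a γ wbar e : ℝ} (hw : 0 ≤ wbar) {M : Weights H m n} :
    M ∈ Omega A B K H X U a γ wbar e ↔ M ∈ weightSet H m n a γ ∧
      ∀ p : ℕ → EuclideanSpace ℝ (Fin n), (∀ k, p k ∈ supBall (Fin n) wbar) →
        fixedState A B K p M ∈ shrink X e ∧ fixedInput A B K p M ∈ shrink U e := by
  have hX : ∀ p : ℕ → EuclideanSpace ℝ (Fin n),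
      act (hX A B K M) (WithLp.toLp 2 fun ks => p (ks.1 + 1) ks.2) = fixedState A B K p M := by
    intro p
    ext r
    rw [act_apply, ← sum_PsiX, sum_Icc_one, Finset.sum_range, Fintype.sum_prod_type]
    simp [hX, act_apply]
  have hU : ∀ p : ℕ → EuclideanSpace ℝ (Fin n),
      act (hU A B K M) (WithLp.toLp 2 fun ks => p (ks.1 + 1) ks.2) = fixedInput A B K p M := by
    intro p
    ext r
    rw [act_apply, ← sum_PsiU, sum_Icc_one, Finset.sum_range, Fintype.sum_prod_type]
    simp [hU, act_apply]
  have hslice : ∀ v ∈ supBall (Fin (2 * H) × Fin n) wbar,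
      ∃ p : ℕ → EuclideanSpace ℝ (Fin n), (∀ k, p k ∈ supBall (Fin n) wbar) ∧
        v = WithLp.toLp 2 fun ks => p (ks.1 + 1) ks.2 := by
    intro v hv
    refine ⟨fun k => WithLp.toLp 2 fun s =>
      if h : k - 1 < 2 * H then v (⟨k - 1, h⟩, s) else 0, fun k s => ?_, ?_⟩
    · by_cases h : k - 1 < 2 * H
      · simpa [h] using hv (⟨k - 1, h⟩, s)
      · simpa [h] using hw
    · ext ⟨k, s⟩
      simp
  refine and_congr_right fun _ => ⟨fun ⟨h1, h2⟩ p hp => ?_, fun h => ⟨?_, ?_⟩⟩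
  · have hmem : (WithLp.toLp 2 fun ks => p (ks.1 + 1) ks.2 :
        EuclideanSpace ℝ (Fin (2 * H) × Fin n)) ∈ supBall _ wbar := fun ks => hp _ _
    exact ⟨hX p ▸ h1 ⟨_, hmem, rfl⟩, hU p ▸ h2 ⟨_, hmem, rfl⟩⟩
  · rintro _ ⟨v, hv, rfl⟩
    obtain ⟨p, hp, rfl⟩ := hslice v hv
    rw [hX]
    exact (h p hp).1
  · rintro _ ⟨v, hv, rfl⟩
    obtain ⟨p, hp, rfl⟩ := hslice v hv
    rw [hU]
    exact (h p hp).2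

/-- The part of the fixed-weight input response that is linear in the weight. -/
noncomputable def inputLin (p : ℕ → EuclideanSpace ℝ (Fin n)) :
    Weights H m n →ₗ[ℝ] EuclideanSpace ℝ (Fin m) :=
  lagSum p - Matrix.toEuclideanLin K ∘ₗ stateLin A B K p

lemma inputLin_apply (p : ℕ → EuclideanSpace ℝ (Fin n)) (M : Weights H m n) :
    inputLin A B K p M = lagSum p M - act K (stateLin A B K p M) := rfl

lemma fixedInput_eq (p : ℕ → EuclideanSpace ℝ (Fin n)) (M : Weights H m n) :
    fixedInput A B K p M = -act K (stateBase A B K H p)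
      + inputLin A B K p M := by
  simp only [fixedInput, fixedState, act_add, inputLin_apply]
  abel

/-- For each history both constraints are affine in the weight, so the set is an intersection of
affine preimages. -/
lemma Omega_eq {X : Set (EuclideanSpace ℝ (Fin n))} {U : Set (EuclideanSpace ℝ (Fin m))}
    {a γ wbar e : ℝ} (hw : 0 ≤ wbar) :
    Omega A B K H X U a γ wbar e = weightSet H m n a γ ∩
      ⋂ p ∈ {p : ℕ → EuclideanSpace ℝ (Fin n) | ∀ k, p k ∈ supBall (Fin n) wbar},
        (stateLin A B K p ⁻¹' ((fun x => stateBase A B K H p + x) ⁻¹' shrink X e)) ∩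
        (inputLin A B K p ⁻¹' ((fun u => -act K (stateBase A B K H p) + u) ⁻¹' shrink U e)) := by
  ext M
  rw [mem_Omega_iff A B K hw]
  simp only [Set.mem_inter_iff, Set.mem_iInter, Set.mem_ofPred_eq, Set.mem_preimage, fixedState,
    fixedInput_eq]

variable {X : Set (EuclideanSpace ℝ (Fin n))} {U : Set (EuclideanSpace ℝ (Fin m))}
  {a γ wbar e : ℝ}

lemma isClosed_Omega (hX : IsClosed X) (hU : IsClosed U) (ha : 0 ≤ a) (hγ1 : γ ≤ 1)
    (hw : 0 ≤ wbar) : IsClosed (Omega A B K H X U a γ wbar e) := by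
  rw [Omega_eq A B K hw, weightSet_eq ha hγ1]
  refine (isClosed_biInter fun i _ => isClosed_iInter fun v => Metric.isClosed_closedBall.preimage
    (LinearMap.continuous_of_finiteDimensional _)).inter (isClosed_biInter fun p _ => ?_)
  exact ((((isClosed_shrink hX e).preimage (by fun_prop)).preimage
    (LinearMap.continuous_of_finiteDimensional _)).inter
    (((isClosed_shrink hU e).preimage (by fun_prop)).preimage
    (LinearMap.continuous_of_finiteDimensional _)))

lemma convex_Omega (hX : Convex ℝ X) (hU : Convex ℝ U) (ha : 0 ≤ a) (hγ1 : γ ≤ 1)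
    (hw : 0 ≤ wbar) : Convex ℝ (Omega A B K H X U a γ wbar e) := by
  rw [Omega_eq A B K hw, weightSet_eq ha hγ1]
  refine (convex_iInter₂ fun i _ => convex_iInter fun v =>
    (convex_closedBall _ _).linear_preimage _).inter (convex_iInter₂ fun p _ => ?_)
  exact (((convex_shrink hX e).translate_preimage_right _).linear_preimage _).inter
    (((convex_shrink hU e).translate_preimage_right _).linear_preimage _)

end Response

/-! ### Imitating the safe linear policy -/

section LinearPolicy

variable {H n m : ℕ} (A : Matrix (Fin n) (Fin n) ℝ) (B : Matrix (Fin n) (Fin m) ℝ)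
  (K Kss : Matrix (Fin m) (Fin n) ℝ)

/-- The weights of the disturbance-action policy that imitates the linear policy `Kss`. -/
noncomputable def linearWeights (H : ℕ) : Weights H m n :=
  WithLp.toLp 2 fun x => ((K - Kss) * (A - B * Kss) ^ (x.1 : ℕ)) x.2.1 x.2.2

lemma block_linearWeights {i : ℕ} (hi : i < H) :
    block (linearWeights A B K Kss H) (i + 1) = (K - Kss) * (A - B * Kss) ^ i := by
  ext r s
  exact block_succ (linearWeights A B K Kss H) ⟨i, hi⟩ r s

/-- The telescoping identity, from $B(K-K_{ss})=(A-BK_{ss})-(A-BK)$. -/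
lemma pow_mul_linearWeights_term (i j : ℕ) :
    (A - B * K) ^ i * B * ((K - Kss) * (A - B * Kss) ^ j)
      = (A - B * K) ^ i * (A - B * Kss) ^ (j + 1) - (A - B * K) ^ (i + 1) * (A - B * Kss) ^ j := by
  have h : B * (K - Kss) = (A - B * Kss) - (A - B * K) := by rw [Matrix.mul_sub]; abel
  rw [← Matrix.mul_assoc, Matrix.mul_assoc _ B, h, mul_sub, sub_mul, pow_succ', pow_succ,
    mul_assoc _ (A - B * Kss)]

lemma PsiX_linearWeights_of_lt {k : ℕ} (hk : k < H) :
    PsiX A B K (fun _ => linearWeights A B K Kss H) (k + 1) = (A - B * Kss) ^ k := by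
  -- Capping exponents at `k` makes the terms with vanishing block telescope too. The end value
  -- $(A-BK)^k$ then cancels the free term of `PsiX`.
  have hterm : ∀ i, (A - B * K) ^ i * B * block (linearWeights A B K Kss H) (k - i)
      = (A - B * K) ^ min i k * (A - B * Kss) ^ (k - i)
        - (A - B * K) ^ min (i + 1) k * (A - B * Kss) ^ (k - (i + 1)) := by
    intro i
    by_cases h : i < k
    · obtain ⟨j, rfl⟩ : ∃ j, k = i + j + 1 := ⟨k - i - 1, by omega⟩
      rw [show i + j + 1 - i = j + 1 by omega, block_linearWeights A B K Kss (by omega),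
        show i + j + 1 - (i + 1) = j by omega, min_eq_left (by omega), min_eq_left (by omega),
        pow_mul_linearWeights_term]
    · rw [block_of_not (by omega), min_eq_right (by omega), min_eq_right (by omega),
        show k - i = 0 by omega, show k - (i + 1) = 0 by omega]
      simp
  rw [PsiX, if_pos (by omega), sum_Icc_one]
  simp only [Nat.add_sub_cancel, Nat.add_sub_add_right, hterm]
  rw [Finset.sum_range_sub' (fun i => (A - B * K) ^ min i k * (A - B * Kss) ^ (k - i))]
  simp [min_eq_right hk.le, Nat.sub_eq_zero_of_le hk.le]

lemma PsiX_linearWeights_of_ge {j : ℕ} (hj : j < H) :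
    PsiX A B K (fun _ => linearWeights A B K Kss H) (H + j + 1)
      = (A - B * K) ^ j * (A - B * Kss) ^ H - (A - B * K) ^ H * (A - B * Kss) ^ j := by
  -- For `i < j` the block index exceeds `H`, so the block vanishes; the `max` freezes the
  -- telescoping there.
  have hterm : ∀ i ∈ Finset.range H,
      (A - B * K) ^ i * B * block (linearWeights A B K Kss H) (H + j - i)
      = (A - B * K) ^ max i j * (A - B * Kss) ^ (H + j - max i j)
        - (A - B * K) ^ max (i + 1) j * (A - B * Kss) ^ (H + j - max (i + 1) j) := by
    intro i hi
    rw [Finset.mem_range] at hi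
    by_cases h : j ≤ i
    · obtain ⟨l, hl⟩ : ∃ l, H + j = i + l + 1 := ⟨H + j - i - 1, by omega⟩
      rw [hl, show i + l + 1 - i = l + 1 by omega, block_linearWeights A B K Kss (by omega),
        max_eq_left h, max_eq_left (by omega), show i + l + 1 - i = l + 1 by omega,
        show i + l + 1 - (i + 1) = l by omega, pow_mul_linearWeights_term]
    · rw [block_of_not (by omega), max_eq_right (by omega), max_eq_right (by omega)]
      simp
  rw [PsiX, if_neg (by omega), sum_Icc_one]
  simp only [Nat.add_sub_cancel, Nat.add_sub_add_right]
  rw [Finset.sum_congr rfl hterm, Finset.sum_range_sub'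
    (fun i => (A - B * K) ^ max i j * (A - B * Kss) ^ (H + j - max i j))]
  simp [max_eq_left hj.le]

lemma fixedState_linearWeights (p : ℕ → EuclideanSpace ℝ (Fin n)) :
    fixedState A B K p (linearWeights A B K Kss H)
      = ∑ s ∈ Finset.range H, act ((A - B * Kss) ^ s) (p (s + 1))
        + (∑ j ∈ Finset.range H, act ((A - B * K) ^ (0 + j))
            (act ((A - B * Kss) ^ H) (p (H + j + 1)))
          - act ((A - B * K) ^ H) (∑ j ∈ Finset.range H,
            act ((A - B * Kss) ^ (0 + j)) (p (H + j + 1)))) := by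
  rw [← sum_PsiX, sum_Icc_one, two_mul, Finset.sum_range_add, act_sum,
    ← Finset.sum_sub_distrib]
  congr 1 <;> refine Finset.sum_congr rfl fun k hk => ?_ <;> rw [Finset.mem_range] at hk
  · rw [PsiX_linearWeights_of_lt A B K Kss hk]
  · rw [PsiX_linearWeights_of_ge A B K Kss hk, sub_act, mul_act, mul_act, zero_add]

lemma lagSum_linearWeights (p : ℕ → EuclideanSpace ℝ (Fin n)) :
    lagSum p (linearWeights A B K Kss H)
      = act (K - Kss) (∑ s ∈ Finset.range H, act ((A - B * Kss) ^ s) (p (s + 1))) := by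
  rw [lagSum_apply, sum_Icc_one, act_sum]
  refine Finset.sum_congr rfl fun s hs => ?_
  rw [block_linearWeights A B K Kss (Finset.mem_range.1 hs), mul_act]

lemma linState_eq_sum (w : ℕ → EuclideanSpace ℝ (Fin n)) (t : ℕ) :
    linState A B Kss w t
      = ∑ s ∈ Finset.range t, act ((A - B * Kss) ^ s) (past w t (s + 1)) := by
  refine recursion_eq_sum (x := linState A B Kss w) rfl (fun s => ?_) t t le_rfl
  rw [linState, sub_act, mul_act, act_neg, sub_eq_add_neg]

variable {A B K Kss}
variable {X : Set (EuclideanSpace ℝ (Fin n))} {U : Set (EuclideanSpace ℝ (Fin m))}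
  {κ γ wbar e e' : ℝ}

/-- Origin of $a=2\kappa^3$: $\|K\|_2+\|K_{ss}\|_2\le2\kappa$, times $\kappa^2$ from the powers. -/
lemma linearWeights_mem_weightSet (hκ : 1 < κ) (hγ1 : γ ≤ 1) (hK : IsStronglyStable A B κ γ K)
    (hKss : IsStronglyStable A B κ γ Kss) :
    linearWeights A B K Kss H ∈ weightSet H m n (coefA κ) γ := by
  have hq : 0 ≤ 1 - γ := by linarith
  intro i hi hiH
  obtain ⟨i, rfl⟩ : ∃ j, i = j + 1 := ⟨i - 1, by omega⟩
  rw [block_linearWeights A B K Kss hiH, Nat.add_sub_cancel,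
    specNorm_le_iff _ (by unfold coefA; positivity)]
  intro v
  have hv := hKss.norm_pow_act_le hγ1 i v
  obtain ⟨-, -, -, -, -, hKn, -⟩ := hK
  obtain ⟨-, -, -, -, -, hKn', -⟩ := hKss
  rw [mul_act, sub_act]
  calc _ ≤ κ * (κ ^ 2 * (1 - γ) ^ i * ‖v‖) + κ * (κ ^ 2 * (1 - γ) ^ i * ‖v‖) :=
        (norm_sub_le _ _).trans
          (add_le_add (norm_act_le_of_le hKn hv) (norm_act_le_of_le hKn' hv))
    _ = _ := by unfold coefA; ring

lemma linearWeights_mem_Omega (hκ : 1 < κ) (hγ0 : 0 < γ) (hγ1 : γ ≤ 1) (hw : 0 ≤ wbar)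
    (hK : IsStronglyStable A B κ γ K) (hKss : IsStronglyStable A B κ γ Kss)
    (hsafe : IsStrictlySafe A B X U wbar e' Kss) (he : 0 ≤ e)
    (hgap : e + κ * (2 * κ ^ 4 * (1 - γ) ^ H * (√(n : ℝ) * wbar) / γ) ≤ e') :
    linearWeights A B K Kss H ∈ Omega A B K H X U (coefA κ) γ wbar e := by
  have hq : 0 ≤ 1 - γ := by linarith
  refine (mem_Omega_iff A B K hw).2
    ⟨linearWeights_mem_weightSet hκ hγ1 hK hKss, fun p hp => ?_⟩
  have hpn : ∀ k, ‖p k‖ ≤ √(n : ℝ) * wbar := fun k => norm_le_of_mem_supBall hw (hp k)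
  -- Feeding the history in reversed time for `H` steps makes lag `k` of the linear controller equal
  -- to `p k`.
  obtain ⟨hx, hu⟩ := hsafe (fun j => p (H - j)) (fun k => hp _) H
  have hstate : linState A B Kss (fun j => p (H - j)) H
      = ∑ s ∈ Finset.range H, act ((A - B * Kss) ^ s) (p (s + 1)) := by
    rw [linState_eq_sum]
    refine Finset.sum_congr rfl fun s hs => ?_
    rw [Finset.mem_range] at hs
    rw [past, if_pos (by omega), show H - (H - (s + 1)) = s + 1 by omega]
  rw [hstate] at hx hu
  have hfs := fixedState_linearWeights (H := H) A B K Kss p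
  set x := ∑ s ∈ Finset.range H, act ((A - B * Kss) ^ s) (p (s + 1)) with hxdef
  set r := ∑ j ∈ Finset.range H, act ((A - B * K) ^ (0 + j))
            (act ((A - B * Kss) ^ H) (p (H + j + 1)))
          - act ((A - B * K) ^ H) (∑ j ∈ Finset.range H,
            act ((A - B * Kss) ^ (0 + j)) (p (H + j + 1))) with hrdef
  have hr : ‖r‖ ≤ 2 * κ ^ 4 * (1 - γ) ^ H * (√(n : ℝ) * wbar) / γ := by
    have h1 : ‖∑ j ∈ Finset.range H, act ((A - B * K) ^ (0 + j))
        (act ((A - B * Kss) ^ H) (p (H + j + 1)))‖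
        ≤ κ ^ 2 * (1 - γ) ^ 0 * (κ ^ 2 * (1 - γ) ^ H * (√(n : ℝ) * wbar)) / γ :=
      norm_sum_pow_act_le hγ0 hγ1 (hK.norm_pow_act_le hγ1) (by positivity)
        (fun s => (hKss.norm_pow_act_le hγ1 H _).trans (by gcongr; exact hpn _)) 0 H
    have h2 := norm_sum_pow_act_le hγ0 hγ1 (hKss.norm_pow_act_le hγ1) (by positivity)
      (fun s => hpn (H + s + 1)) 0 H
    have h3 := (hK.norm_pow_act_le hγ1 H _).trans
      (mul_le_mul_of_nonneg_left h2 (by positivity))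
    calc ‖r‖ ≤ _ := norm_sub_le _ _
      _ ≤ _ := add_le_add h1 h3
      _ = _ := by ring
  have hKr : ‖-act K r‖ ≤ κ * (2 * κ ^ 4 * (1 - γ) ^ H * (√(n : ℝ) * wbar) / γ) := by
    obtain ⟨-, -, -, -, -, hKn, -⟩ := hK
    rw [norm_neg]
    exact norm_act_le_of_le hKn hr
  constructor
  · rw [hfs]
    refine add_mem_shrink hx (hr.trans ?_) he hgap
    exact le_mul_of_one_le_left (by positivity) hκ.le
  · have hfi : fixedInput A B K p (linearWeights A B K Kss H) = -act Kss x + -act K r := by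
      rw [fixedInput, hfs, lagSum_linearWeights, sub_act, act_add]
      abel
    rw [hfi]
    exact add_mem_shrink hu hKr he hgap

end LinearPolicy

/-! ### Bounding the gradient of the approximate cost -/

section Gradient

lemma norm_gradient_eq {V : Type} [NormedAddCommGroup V] [InnerProductSpace ℝ V]
    [CompleteSpace V] (f : V → ℝ) (v : V) : ‖gradient f v‖ = ‖fderiv ℝ f v‖ := by
  rw [gradient, LinearIsometryEquiv.norm_map]

/-- Chain rule: the joint derivative is the sum of its two partials, each composed with one linear
map. Fréchet derivatives are used because `E × F` carries the sup norm, not an inner product. -/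
lemma norm_gradient_comp_affine_le {V E F : Type} [NormedAddCommGroup V] [InnerProductSpace ℝ V]
    [CompleteSpace V] [NormedAddCommGroup E] [InnerProductSpace ℝ E] [CompleteSpace E]
    [NormedAddCommGroup F] [InnerProductSpace ℝ F] [CompleteSpace F] {f : E → F → ℝ}
    (hf : Differentiable ℝ fun p : E × F => f p.1 p.2) (x₀ : E) (Lx : V →L[ℝ] E) (u₀ : F)
    (Lu : V →L[ℝ] F) (v : V) {g lx lu : ℝ} (hlx : 0 ≤ lx) (hlu : 0 ≤ lu)
    (hLx : ∀ d, ‖Lx d‖ ≤ lx * ‖d‖) (hLu : ∀ d, ‖Lu d‖ ≤ lu * ‖d‖)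
    (hgx : ‖gradient (fun x => f x (u₀ + Lu v)) (x₀ + Lx v)‖ ≤ g)
    (hgu : ‖gradient (fun u => f (x₀ + Lx v) u) (u₀ + Lu v)‖ ≤ g) :
    ‖gradient (fun v => f (x₀ + Lx v) (u₀ + Lu v)) v‖ ≤ g * (lx + lu) := by
  have hg : 0 ≤ g := (norm_nonneg _).trans hgx
  have hd := (hf (x₀ + Lx v, u₀ + Lu v)).hasFDerivAt
  set f' := fderiv ℝ (fun p : E × F => f p.1 p.2) (x₀ + Lx v, u₀ + Lu v)
  have hdx : HasFDerivAt (fun x => f x (u₀ + Lu v))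
      (f'.comp (ContinuousLinearMap.inl ℝ E F)) (x₀ + Lx v) :=
    HasFDerivAt.comp (g := fun p : E × F => f p.1 p.2) (f := fun x => (x, u₀ + Lu v))
      (x₀ + Lx v) hd (hasFDerivAt_prodMk_left (x₀ + Lx v) (u₀ + Lu v))
  have hdu : HasFDerivAt (fun u => f (x₀ + Lx v) u)
      (f'.comp (ContinuousLinearMap.inr ℝ E F)) (u₀ + Lu v) :=
    HasFDerivAt.comp (g := fun p : E × F => f p.1 p.2) (f := fun u => (x₀ + Lx v, u))
      (u₀ + Lu v) hd (hasFDerivAt_prodMk_right (x₀ + Lx v) (u₀ + Lu v))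
  have hdv : HasFDerivAt (fun v => f (x₀ + Lx v) (u₀ + Lu v)) (f'.comp (Lx.prod Lu)) v :=
    HasFDerivAt.comp (g := fun p : E × F => f p.1 p.2)
      (f := fun v => (x₀ + Lx v, u₀ + Lu v)) v hd
      ((Lx.hasFDerivAt.const_add x₀).prodMk (Lu.hasFDerivAt.const_add u₀))
  rw [norm_gradient_eq, hdx.fderiv] at hgx
  rw [norm_gradient_eq, hdu.fderiv] at hgu
  rw [norm_gradient_eq, hdv.fderiv]
  refine ContinuousLinearMap.opNorm_le_bound _ (by positivity) fun d => ?_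
  have e : (f'.comp (Lx.prod Lu)) d = (f'.comp (ContinuousLinearMap.inl ℝ E F)) (Lx d)
      + (f'.comp (ContinuousLinearMap.inr ℝ E F)) (Lu d) := by
    simp [← map_add]
  rw [e]
  calc _ ≤ g * (lx * ‖d‖) + g * (lu * ‖d‖) := (norm_add_le _ _).trans
        (add_le_add (ContinuousLinearMap.le_of_opNorm_le_of_le _ hgx (hLx d))
          (ContinuousLinearMap.le_of_opNorm_le_of_le _ hgu (hLu d)))
    _ = _ := by ring

variable {H n m T : ℕ} {A : Matrix (Fin n) (Fin n) ℝ} {B : Matrix (Fin n) (Fin m) ℝ}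
  {K : Matrix (Fin m) (Fin n) ℝ} {κ γ a σ G : ℝ}
  {c : ℕ → EuclideanSpace ℝ (Fin n) → EuclideanSpace ℝ (Fin m) → ℝ}

lemma LossAssumption.nonneg (hc : LossAssumption T G c) : 0 ≤ G := by
  simpa using (norm_nonneg _).trans (hc.grad_state 0 (Nat.zero_le T) 1 one_pos 0 0 (by simp)
    (by simp))

/-- Letting the radius decrease to `D` includes `D = 0`, which the assumption itself leaves out. -/
lemma LossAssumption.grad_le (hc : LossAssumption T G c) {t : ℕ} (ht : t ≤ T) {D : ℝ}
    (hD : 0 ≤ D) {x : EuclideanSpace ℝ (Fin n)} {u : EuclideanSpace ℝ (Fin m)} (hx : ‖x‖ ≤ D)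
    (hu : ‖u‖ ≤ D) :
    ‖gradient (fun x' => c t x' u) x‖ ≤ G * D ∧ ‖gradient (fun u' => c t x u') u‖ ≤ G * D := by
  have hlim : Filter.Tendsto (fun r => G * r) (nhdsWithin D (Set.Ioi D)) (nhds (G * D)) :=
    ((continuous_const_mul G).tendsto D).mono_left nhdsWithin_le_nhds
  constructor <;> refine ge_of_tendsto hlim ?_ <;>
    filter_upwards [self_mem_nhdsWithin] with r (hr : D < r)
  · exact hc.grad_state t ht r (hD.trans_lt hr) x u (hx.trans hr.le) (hu.trans hr.le)
  · exact hc.grad_input t ht r (hD.trans_lt hr) x u (hx.trans hr.le) (hu.trans hr.le)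

lemma specNorm_le_kappaB (B : Matrix (Fin n) (Fin m) ℝ) : specNorm B ≤ kappaB B := le_max_left _ _

lemma one_le_kappaB (B : Matrix (Fin n) (Fin m) ℝ) : 1 ≤ kappaB B := le_max_right _ _

lemma norm_stateLin_le (hγ0 : 0 < γ) (hγ1 : γ ≤ 1) (hK : IsStronglyStable A B κ γ K)
    {C : ℝ} (hC : 0 ≤ C) {p : ℕ → EuclideanSpace ℝ (Fin n)} {M : Weights H m n}
    (h : ∀ s, ‖lagSum (fun i => p (s + 1 + i)) M‖ ≤ C) :
    ‖stateLin A B K p M‖ ≤ κ ^ 2 * (kappaB B * C) / γ := by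
  have hB := one_le_kappaB B
  rw [stateLin_apply]
  simpa using norm_sum_pow_act_le hγ0 hγ1 (hK.norm_pow_act_le hγ1) (C := kappaB B * C)
    (by positivity) (fun s => norm_act_le_of_le (specNorm_le_kappaB B) (h s)) 0 H

lemma norm_stateBase_le (hγ0 : 0 < γ) (hγ1 : γ ≤ 1) (hK : IsStronglyStable A B κ γ K)
    (hσ : 0 ≤ σ) {p : ℕ → EuclideanSpace ℝ (Fin n)} (hp : ∀ k, ‖p k‖ ≤ σ) (H : ℕ) :
    ‖stateBase A B K H p‖ ≤ κ ^ 2 * σ / γ := by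
  simpa [stateBase] using norm_sum_pow_act_le hγ0 hγ1 (hK.norm_pow_act_le hγ1) hσ
    (fun s => hp (s + 1)) 0 H

lemma approxCost_eq (w : ℕ → EuclideanSpace ℝ (Fin n)) (t : ℕ) (M : Weights H m n) :
    approxCost A B K c w t M
      = c t (stateBase A B K H (past w t) + stateLin A B K (past w t) M)
        (-act K (stateBase A B K H (past w t)) + inputLin A B K (past w t) M) := by
  rw [← fixedInput_eq, approxCost, surrState, surrInput, sum_PsiX, sum_PsiU, fixedState]

/-- The first factor is `G` times a common bound on surrogate state and input over the weight set;
the second is the sum of the Lipschitz constants of both in the weight. -/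
lemma norm_gradient_approxCost_le (hH : 0 < H) (hκ : 1 < κ) (hγ0 : 0 < γ) (hγ1 : γ ≤ 1)
    (hK : IsStronglyStable A B κ γ K) (ha : 0 ≤ a) (hσ : 0 ≤ σ) (hc : LossAssumption T G c)
    {t : ℕ} (ht : t ≤ T) {w : ℕ → EuclideanSpace ℝ (Fin n)} (hw : ∀ k, ‖past w t k‖ ≤ σ)
    {M : Weights H m n} (hM : M ∈ weightSet H m n a γ) :
    ‖gradient (approxCost A B K c w t) M‖
      ≤ G * (H * σ * (κ ^ 3 * (1 + kappaB B * a) + a) / γ)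
        * (√(H : ℝ) * σ * (κ ^ 2 * kappaB B * (1 + κ) / γ + 1)) := by
  have hB := one_le_kappaB B
  have hH1 : (1 : ℝ) ≤ H := by exact_mod_cast hH
  have hKn : specNorm K ≤ κ := by
    obtain ⟨-, -, -, -, -, hKn, -⟩ := hK
    exact hKn
  have hcost : approxCost A B K c w t = fun M : Weights H m n =>
      c t (stateBase A B K H (past w t) + (stateLin A B K (past w t)).toContinuousLinearMap M)
        (-act K (stateBase A B K H (past w t))
          + (inputLin A B K (past w t)).toContinuousLinearMap M) :=
    funext fun M => approxCost_eq w t M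
  have hsl : ∀ d : Weights H m n, ‖stateLin A B K (past w t) d‖
      ≤ κ ^ 2 * kappaB B / γ * (√(H : ℝ) * σ) * ‖d‖ := fun d =>
    (norm_stateLin_le hγ0 hγ1 hK (by positivity)
      fun s => norm_lagSum_le hσ (fun i => hw _) d).trans_eq (by ring)
  have hil : ∀ d : Weights H m n, ‖inputLin A B K (past w t) d‖
      ≤ (1 + κ * (κ ^ 2 * kappaB B / γ)) * (√(H : ℝ) * σ) * ‖d‖ := fun d =>
    (norm_sub_le _ _).trans ((add_le_add (norm_lagSum_le hσ hw d)
      (norm_act_le_of_le hKn (hsl d))).trans_eq (by ring))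
  have hx1 : ‖stateBase A B K H (past w t) + stateLin A B K (past w t) M‖
      ≤ κ ^ 2 * (σ + kappaB B * (H * (a * σ))) / γ := by
    calc _ ≤ κ ^ 2 * σ / γ + κ ^ 2 * (kappaB B * (H * (a * σ))) / γ :=
          (norm_add_le _ _).trans (add_le_add (norm_stateBase_le hγ0 hγ1 hK hσ hw H)
            (norm_stateLin_le hγ0 hγ1 hK (by positivity)
              fun s => norm_lagSum_le_of_mem ha hγ0 hγ1 (fun i => hw _) hM))
      _ = _ := by ring
  have hu1 : ‖-act K (stateBase A B K H (past w t)) + inputLin A B K (past w t) M‖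
      ≤ H * (a * σ) + κ * (κ ^ 2 * (σ + kappaB B * (H * (a * σ))) / γ) := by
    rw [← fixedInput_eq, fixedInput]
    exact (norm_sub_le _ _).trans (add_le_add (norm_lagSum_le_of_mem ha hγ0 hγ1 hw hM)
      (norm_act_le_of_le hKn hx1))
  have hD2 : H * (a * σ) + κ * (κ ^ 2 * (σ + kappaB B * (H * (a * σ))) / γ)
      ≤ H * σ * (κ ^ 3 * (1 + kappaB B * a) + a) / γ := by
    rw [le_div_iff₀ hγ0]
    have h1 : H * (a * σ) * γ ≤ H * (a * σ) * 1 := by gcongr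
    have h2 : κ ^ 3 * σ * 1 ≤ κ ^ 3 * σ * H := by gcongr
    calc _ = H * (a * σ) * γ + κ ^ 3 * σ * 1 + κ ^ 3 * (kappaB B * (H * (a * σ))) := by
          field_simp
          ring
      _ ≤ _ := by linarith
  have hD1 : κ ^ 2 * (σ + kappaB B * (H * (a * σ))) / γ
      ≤ H * (a * σ) + κ * (κ ^ 2 * (σ + kappaB B * (H * (a * σ))) / γ) := by
    have h1 : κ ^ 2 * (σ + kappaB B * (H * (a * σ))) / γ
      ≤ κ * (κ ^ 2 * (σ + kappaB B * (H * (a * σ))) / γ) :=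
      le_mul_of_one_le_left (by positivity) hκ.le
    have h2 : 0 ≤ H * (a * σ) := by positivity
    linarith
  obtain ⟨hgx, hgu⟩ := hc.grad_le ht (by positivity) (hx1.trans (hD1.trans hD2)) (hu1.trans hD2)
  rw [hcost]
  refine (norm_gradient_comp_affine_le (f := c t) (hc.differentiable t ht)
    (stateBase A B K H (past w t)) (stateLin A B K (past w t)).toContinuousLinearMap
    (-act K (stateBase A B K H (past w t))) (inputLin A B K (past w t)).toContinuousLinearMap M
    (by positivity) (by positivity) hsl hil hgx hgu).trans_eq ?_
  ring

end Gradient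

/-! ### Distance between the true trajectory and the fixed-weight response -/

section Algorithm

variable {H n m : ℕ} {A : Matrix (Fin n) (Fin n) ℝ} {B : Matrix (Fin n) (Fin m) ℝ}
  {K : Matrix (Fin m) (Fin n) ℝ} {κ γ a σ : ℝ}

lemma norm_sub_le_of_norm_step_le {V : Type} [NormedAddCommGroup V] {M : ℕ → V} {μ : ℝ} {t : ℕ}
    (h : ∀ s < t, ‖M (s + 1) - M s‖ ≤ μ) {k : ℕ} (hk : k ≤ t) :
    ‖M (t - k) - M t‖ ≤ k * μ := by
  induction k with
  | zero => simp
  | succ k ih =>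
    have h1 := h (t - (k + 1)) (by omega)
    rw [show t - (k + 1) + 1 = t - k by omega, norm_sub_rev] at h1
    calc _ ≤ ‖M (t - (k + 1)) - M (t - k)‖ + ‖M (t - k) - M t‖ :=
          norm_sub_le_norm_sub_add_norm_sub ..
      _ ≤ μ + k * μ := add_le_add h1 (ih (by omega))
      _ = _ := by push_cast; ring

lemma norm_past_le {w : ℕ → EuclideanSpace ℝ (Fin n)} {t : ℕ} (hσ : 0 ≤ σ)
    (hw : ∀ j ≤ t, ‖w j‖ ≤ σ) (k : ℕ) : ‖past w t k‖ ≤ σ := by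
  unfold past
  split
  · exact hw _ (by omega)
  · simpa using hσ

/-- The state generated by slowly varying weights is close to the fixed-weight response. -/
lemma norm_sub_fixedState_le (hγ0 : 0 < γ) (hγ1 : γ ≤ 1)
    (hK : IsStronglyStable A B κ γ K) (ha : 0 ≤ a) (hσ : 0 ≤ σ)
    {w x : ℕ → EuclideanSpace ℝ (Fin n)} {M : ℕ → Weights H m n} {t : ℕ} {μ : ℝ} (hμ : 0 ≤ μ)
    (h0 : x 0 = 0)
    (hx : ∀ s, x (s + 1) = act (A - B * K) (x s) + (w s + act B (lagSum (past w s) (M s))))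
    (hM : ∀ s, M s ∈ weightSet H m n a γ) (hstep : ∀ s < t, ‖M (s + 1) - M s‖ ≤ μ)
    (hw : ∀ j ≤ t, ‖w j‖ ≤ σ) :
    ‖x t - fixedState A B K (past w t) (M t)‖
      ≤ κ ^ 2 * (1 - γ) ^ H * (σ + kappaB B * (H * (a * σ))) / γ
        + κ ^ 2 * (kappaB B * (√(m : ℝ) * (√(H : ℝ) * σ * μ))) / γ ^ 2 := by
  have hB := one_le_kappaB B
  set d : ℕ → EuclideanSpace ℝ (Fin n) := fun s => w s + act B (lagSum (past w s) (M s)) with hd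
  have hdn : ∀ j ≤ t, ‖d j‖ ≤ σ + kappaB B * (H * (a * σ)) := fun j hj =>
    (norm_add_le _ _).trans (add_le_add (hw j hj) (norm_act_le_of_le (specNorm_le_kappaB B)
      (norm_lagSum_le_of_mem ha hγ0 hγ1 (norm_past_le hσ fun i hi => hw i (hi.trans hj)) (hM j))))
  -- Any horizon of at least `t` is allowed; `H + t` lets the sum be split at lag `H` without
  -- comparing `H` and `t`.
  have hxt := recursion_eq_sum h0 hx t (H + t) (by omega)
  rw [Finset.sum_range_add] at hxt
  have htail := norm_sum_pow_act_le hγ0 hγ1 (hK.norm_pow_act_le hγ1) (by positivity)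
    (fun s => norm_past_le (by positivity) hdn (H + s + 1)) H t
  -- Linearity in the weight turns the replacement of $M_{t-s-1}$ by $M_t$ into the action of their
  -- difference, of norm at most `(s + 1) * μ`. Lags reaching before time zero contribute nothing.
  set y : ℕ → EuclideanSpace ℝ (Fin m) := fun s => if s + 1 ≤ t then
    lagSum (fun i => past w t (s + 1 + i)) (M (t - (s + 1)) - M t) else 0 with hy
  have hyn : ∀ s, ‖act B (y s)‖
      ≤ kappaB B * (√(m : ℝ) * (√(H : ℝ) * σ * μ)) * ((s : ℝ) + 1) := by
    intro s
    have : ‖y s‖ ≤ √(m : ℝ) * (√(H : ℝ) * σ * (((s : ℝ) + 1) * μ)) := by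
      by_cases hs : s + 1 ≤ t
      · simp only [hy, if_pos hs]
        refine (norm_lagSum_le_sqrt hσ (fun i => norm_past_le hσ hw _) _).trans ?_
        gcongr
        simpa using norm_sub_le_of_norm_step_le hstep hs
      · simp only [hy, if_neg hs, norm_zero]
        positivity
    exact (norm_act_le_of_le (specNorm_le_kappaB B) this).trans_eq (by ring)
  have hhead : ∑ s ∈ Finset.range H, act ((A - B * K) ^ s) (past d t (s + 1))
      - fixedState A B K (past w t) (M t)
      = ∑ s ∈ Finset.range H, act ((A - B * K) ^ s) (act B (y s)) := by
    rw [fixedState, stateBase, stateLin_apply, ← Finset.sum_add_distrib,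
      ← Finset.sum_sub_distrib]
    refine Finset.sum_congr rfl fun s _ => ?_
    rw [← act_add, ← act_sub]
    congr 1
    by_cases hs : s + 1 ≤ t
    · have hp : past w (t - (s + 1)) = fun i => past w t (s + 1 + i) := by
        funext i
        unfold past
        by_cases hi : s + 1 + i ≤ t
        · rw [if_pos (by omega), if_pos hi, show t - (s + 1) - i = t - (s + 1 + i) by omega]
        · rw [if_neg (by omega), if_neg hi]
      simp only [hy, if_pos hs, map_sub, act_sub]
      rw [past, if_pos hs, past, if_pos hs, hd]
      simp only [hp]
      abel
    · have hp : (fun i => past w t (s + 1 + i)) = fun _ => 0 := by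
        funext i
        rw [past, if_neg (by omega)]
      simp only [hy, if_neg hs, hp]
      rw [past, if_neg hs, past, if_neg hs]
      simp [lagSum_apply, act_zero]
  have hlin := norm_sum_pow_act_le_of_linear hγ0 hγ1 (hK.norm_pow_act_le hγ1) (by positivity)
    hyn H
  rw [hxt, add_sub_right_comm, hhead, add_comm]
  exact (norm_add_le _ _).trans (add_le_add htail hlin)

variable {c : ℕ → EuclideanSpace ℝ (Fin n) → EuclideanSpace ℝ (Fin m) → ℝ} {η : ℝ}
  {S : Set (Weights H m n)} {M0 : Weights H m n} {w : ℕ → EuclideanSpace ℝ (Fin n)}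

lemma dacInput_eq (t : ℕ) (M : Weights H m n) (x : EuclideanSpace ℝ (Fin n)) :
    dacInput K w t M x = -act K x + lagSum (past w t) M := by
  rw [dacInput, lagSum_apply]

lemma ogdState_succ (t : ℕ) :
    ogdState A B K c η S M0 w (t + 1) = act (A - B * K) (ogdState A B K c η S M0 w t)
      + (w t + act B (lagSum (past w t) (ogdWeight A B K c η S M0 w t))) := by
  rw [ogdState, dacInput_eq, act_add, act_neg, sub_act, mul_act]
  abel

lemma ogdWeight_mem (hS : IsClosed S) (hM0 : M0 ∈ S) (t : ℕ) :
    ogdWeight A B K c η S M0 w t ∈ S := by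
  cases t with
  | zero => exact hM0
  | succ t => exact (proj_spec hS ⟨M0, hM0⟩ _).1

/-- The current weight already lies in `S`, so projecting cannot lengthen the gradient step taken
from it. -/
lemma norm_ogdWeight_succ_sub_le (hS : IsClosed S) (hconv : Convex ℝ S) (hM0 : M0 ∈ S)
    (hη : 0 ≤ η) (t : ℕ) :
    ‖ogdWeight A B K c η S M0 w (t + 1) - ogdWeight A B K c η S M0 w t‖
      ≤ η * ‖gradient (approxCost A B K c w t) (ogdWeight A B K c η S M0 w t)‖ := by
  refine (norm_proj_sub_le hS hconv (ogdWeight_mem hS hM0 t) _).trans_eq ?_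
  rw [sub_sub_cancel_left, norm_neg, norm_smul, Real.norm_of_nonneg hη]

end Algorithm

/-! ### Matching the error bounds with the constants of the theorem -/

section Constants

variable {n m H : ℕ} {κ κB γ wbar G η : ℝ}

lemma eps1_nonneg (hκ : 1 < κ) (hB : 1 ≤ κB) (hγ0 : 0 < γ) (hγ1 : γ ≤ 1) (hw : 0 ≤ wbar) :
    0 ≤ eps1 n H κ κB γ wbar := by
  have hq : 0 ≤ 1 - γ := by linarith
  unfold eps1 coefA
  positivity

lemma eps2_nonneg (hκ : 1 < κ) (hB : 1 ≤ κB) (hγ0 : 0 < γ) (hw : 0 ≤ wbar) (hG : 0 ≤ G)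
    (hη : 0 ≤ η) : 0 ≤ eps2 n m H κ κB γ wbar G η := by
  unfold eps2 coefA
  positivity

lemma eps3_nonneg (hκ : 1 < κ) (hγ1 : γ ≤ 1) (hw : 0 ≤ wbar) : 0 ≤ eps3 n H κ γ wbar := by
  have hq : 0 ≤ 1 - γ := by linarith
  unfold eps3
  positivity

lemma imitation_error_le_eps1 (hH : 0 < H) (hκ : 1 < κ) (hB : 1 ≤ κB) (hγ0 : 0 < γ) (hγ1 : γ ≤ 1)
    (hw : 0 ≤ wbar) :
    κ * (2 * κ ^ 4 * (1 - γ) ^ H * (√(n : ℝ) * wbar) / γ) ≤ eps1 n H κ κB γ wbar := by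
  have hq : 0 ≤ 1 - γ := by linarith
  have hH1 : (1 : ℝ) ≤ H := by exact_mod_cast hH
  have ha : 0 ≤ coefA κ := by unfold coefA; positivity
  have h : 2 * κ ^ 2 * 1 ≤ (2 * κ ^ 3 + 2 * coefA κ * κ ^ 3 * κB + coefA κ) * H := by
    have h1 : κ ^ 2 ≤ κ ^ 3 := pow_le_pow_right₀ hκ.le (by norm_num)
    have h2 : 0 ≤ 2 * coefA κ * κ ^ 3 * κB := by positivity
    gcongr
    linarith
  calc _ = wbar * κ ^ 3 / γ * √(n : ℝ) * (1 - γ) ^ H * (2 * κ ^ 2 * 1) := by ring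
    _ ≤ wbar * κ ^ 3 / γ * √(n : ℝ) * (1 - γ) ^ H
        * ((2 * κ ^ 3 + 2 * coefA κ * κ ^ 3 * κB + coefA κ) * H) := by gcongr
    _ = _ := by unfold eps1; ring

lemma truncation_error_le_eps1 (hH : 0 < H) (hκ : 1 < κ) (hB : 1 ≤ κB) (hγ0 : 0 < γ) (hγ1 : γ ≤ 1)
    (hw : 0 ≤ wbar) :
    κ * (κ ^ 2 * (1 - γ) ^ H
        * (√(n : ℝ) * wbar + κB * (H * (coefA κ * (√(n : ℝ) * wbar)))) / γ)
      ≤ eps1 n H κ κB γ wbar := by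
  have hq : 0 ≤ 1 - γ := by linarith
  have hH1 : (1 : ℝ) ≤ H := by exact_mod_cast hH
  have ha : 0 ≤ coefA κ := by unfold coefA; positivity
  have hκ3 : 1 ≤ κ ^ 3 := one_le_pow₀ hκ.le
  have h : 1 + κB * H * coefA κ ≤ (2 * κ ^ 3 + 2 * coefA κ * κ ^ 3 * κB + coefA κ) * H := by
    have h1 : 1 * 1 ≤ κ ^ 3 * H := by gcongr
    have h2 : κB * H * coefA κ * 1 ≤ κB * H * coefA κ * κ ^ 3 := by gcongr
    have h3 : 0 ≤ κB * H * coefA κ * κ ^ 3 := by positivity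
    have h4 : 0 ≤ coefA κ * H := by positivity
    linarith
  calc _ = wbar * κ ^ 3 / γ * √(n : ℝ) * (1 - γ) ^ H * (1 + κB * H * coefA κ) := by ring
    _ ≤ wbar * κ ^ 3 / γ * √(n : ℝ) * (1 - γ) ^ H
        * ((2 * κ ^ 3 + 2 * coefA κ * κ ^ 3 * κB + coefA κ) * H) := by gcongr
    _ = _ := by unfold eps1; ring

/-- Of $\gamma^{-4}$, two powers come from the drift sum, one from the radius bound and one from the
Lipschitz constants. The three disturbance norms give $n^{3/2}\overline w^3$. -/
lemma variation_error_le_eps2 (hκ : 1 < κ) (hB : 1 ≤ κB) (hγ0 : 0 < γ)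
    (hγ1 : γ ≤ 1) (hw : 0 ≤ wbar) (hG : 0 ≤ G) (hη : 0 ≤ η) :
    κ * (κ ^ 2 * (κB * (√(m : ℝ) * (√(H : ℝ) * (√(n : ℝ) * wbar) *
        (η * (G * (H * (√(n : ℝ) * wbar) * (κ ^ 3 * (1 + κB * coefA κ) + coefA κ) / γ)
        * (√(H : ℝ) * (√(n : ℝ) * wbar) * (κ ^ 2 * κB * (1 + κ) / γ + 1))))))) / γ ^ 2)
      ≤ eps2 n m H κ κB γ wbar G η := by
  have ha : 0 ≤ coefA κ := by unfold coefA; positivity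
  have hκ3 : 1 ≤ κ ^ 3 := one_le_pow₀ hκ.le
  have hκ2 : 1 ≤ κ ^ 2 := one_le_pow₀ hκ.le
  have h1 : κ ^ 3 * (1 + κB * coefA κ) + coefA κ ≤ κ ^ 3 + 2 * coefA κ * κ ^ 3 * κB := by
    have : coefA κ * (1 * 1) ≤ coefA κ * (κ ^ 3 * κB) := by gcongr
    linarith
  have h2 : κ ^ 2 * κB * (1 + κ) + γ ≤ 2 * (κ ^ 2 * κB * (1 + κ)) := by
    have : 1 * 1 * 1 ≤ κ ^ 2 * κB * (1 + κ) := by gcongr; linarith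
    linarith
  have hHs : √(H : ℝ) * √(H : ℝ) = H := Real.mul_self_sqrt (by positivity)
  have hns : √((m : ℝ) * (n : ℝ) ^ 3) = √(m : ℝ) * √(n : ℝ) ^ 3 := by
    have : (n : ℝ) ^ 3 = (√(n : ℝ) ^ 3) ^ 2 := by
      rw [← pow_mul, mul_comm, pow_mul, Real.sq_sqrt (by positivity)]
    rw [Real.sqrt_mul (by positivity), this, Real.sqrt_sq (by positivity)]
  have h3 : κ ^ 2 * κB * (1 + κ) / γ + 1 = (κ ^ 2 * κB * (1 + κ) + γ) / γ := by
    field_simp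
  calc _ = G * wbar ^ 3 * √(m : ℝ) * √(n : ℝ) ^ 3 * η * H * (√(H : ℝ) * √(H : ℝ)) / γ ^ 4
        * κ ^ 3 * κB * (κ ^ 3 * (1 + κB * coefA κ) + coefA κ)
        * (κ ^ 2 * κB * (1 + κ) + γ) := by rw [h3]; field_simp
    _ ≤ G * wbar ^ 3 * √(m : ℝ) * √(n : ℝ) ^ 3 * η * H * (√(H : ℝ) * √(H : ℝ)) / γ ^ 4
        * κ ^ 3 * κB * (κ ^ 3 + 2 * coefA κ * κ ^ 3 * κB)
        * (2 * (κ ^ 2 * κB * (1 + κ))) := by gcongr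
    -- Only half of the constant 4 in $c_2$ is needed; this fills in the rest.
    _ ≤ 2 * (G * wbar ^ 3 * √(m : ℝ) * √(n : ℝ) ^ 3 * η * H * (√(H : ℝ) * √(H : ℝ)) / γ ^ 4
        * κ ^ 3 * κB * (κ ^ 3 + 2 * coefA κ * κ ^ 3 * κB)
        * (2 * (κ ^ 2 * κB * (1 + κ)))) := le_mul_of_one_le_left (by positivity) one_le_two
    _ = _ := by rw [hHs, eps2, hns]; ring

end Constants

end OGDBZC

/-! ### The safety theorem -/

theorem theorem1 {n m H T : ℕ}
    (A : Matrix (Fin n) (Fin n) ℝ) (B : Matrix (Fin n) (Fin m) ℝ)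
    (X : Set (EuclideanSpace ℝ (Fin n))) (U : Set (EuclideanSpace ℝ (Fin m)))
    (hXclosed : IsClosed X) (hXconvex : Convex ℝ X) (hX0 : 0 ∈ X)
    (hUclosed : IsClosed U) (hUconvex : Convex ℝ U) (hU0 : 0 ∈ U)
    (wbar κ γ : ℝ) (hwbar : 0 ≤ wbar) (hκ : 1 < κ) (hγ0 : 0 < γ) (hγ1 : γ ≤ 1)
    -- existence of a strictly safe, strongly stable linear policy
    (εstar : ℝ) (hεstar : 0 < εstar)
    (hKss : ∃ Kss : Matrix (Fin m) (Fin n) ℝ,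
      IsStronglyStable A B κ γ Kss ∧ IsStrictlySafe A B X U wbar εstar Kss)
    -- the stage costs
    (G : ℝ) (c : ℕ → EuclideanSpace ℝ (Fin n) → EuclideanSpace ℝ (Fin m) → ℝ)
    (hc : LossAssumption T G c)
    -- the inputs of the algorithm
    (K : Matrix (Fin m) (Fin n) ℝ) (hK : IsStronglyStable A B κ γ K)
    (ε η : ℝ) (hε : 0 ≤ ε) (hη : 0 ≤ η) (hH0 : 0 < H)
    (hH : Real.log (2 * κ ^ 2) / Real.log ((1 - γ)⁻¹) ≤ (H : ℝ))
    (hlower : eps1 n H κ (kappaB B) γ wbar + eps2 n m H κ (kappaB B) γ wbar G η ≤ ε)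
    (hupper : ε ≤ εstar - eps1 n H κ (kappaB B) γ wbar - eps3 n H κ γ wbar) :
    (Omega A B K H X U (coefA κ) γ wbar ε).Nonempty ∧
    ∀ M0 ∈ Omega A B K H X U (coefA κ) γ wbar ε,
    ∀ w : ℕ → EuclideanSpace ℝ (Fin n), (∀ k ≤ T, w k ∈ supBall (Fin n) wbar) →
    ∀ t ≤ T,
      ogdState A B K c η (Omega A B K H X U (coefA κ) γ wbar ε) M0 w t ∈ X ∧
      ogdInput A B K c η (Omega A B K H X U (coefA κ) γ wbar ε) M0 w t ∈ U := by
  have hB := one_le_kappaB B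
  have hG := hc.nonneg
  have ha : 0 ≤ coefA κ := by unfold coefA; positivity
  have he1 := eps1_nonneg (n := n) (H := H) hκ hB hγ0 hγ1 hwbar
  have he2 := eps2_nonneg (n := n) (m := m) (H := H) hκ hB hγ0 hwbar hG hη
  have he3 := eps3_nonneg (n := n) (H := H) hκ hγ1 hwbar
  have hσ : 0 ≤ √(n : ℝ) * wbar := by positivity
  constructor
  · obtain ⟨Kss, hst, hsafe⟩ := hKss
    refine ⟨linearWeights A B K Kss H,
      linearWeights_mem_Omega hκ hγ0 hγ1 hwbar hK hst hsafe hε ?_⟩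
    have := imitation_error_le_eps1 (n := n) hH0 hκ hB hγ0 hγ1 hwbar
    linarith
  intro M0 hM0 w hw t ht
  have hcl := isClosed_Omega (e := ε) A B K (H := H) hXclosed hUclosed ha hγ1 hwbar
  have hcv := convex_Omega (e := ε) A B K (H := H) hXconvex hUconvex ha hγ1 hwbar
  set S := Omega A B K H X U (coefA κ) γ wbar ε with hS
  set M := ogdWeight A B K c η S M0 w with hMdef
  have hMS : ∀ s, M s ∈ S := ogdWeight_mem hcl hM0
  have hMW : ∀ s, M s ∈ weightSet H m n (coefA κ) γ := fun s => (hMS s).1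
  have hwn : ∀ j ≤ T, ‖w j‖ ≤ √(n : ℝ) * wbar := fun j hj =>
    norm_le_of_mem_supBall hwbar (hw j hj)
  have hstep := fun s (hs : s < t) =>
    (norm_ogdWeight_succ_sub_le (A := A) (B := B) (K := K) (c := c) (w := w) hcl hcv hM0 hη
      s).trans (mul_le_mul_of_nonneg_left (norm_gradient_approxCost_le hH0 hκ hγ0 hγ1 hK ha hσ hc
        (hs.le.trans ht) (norm_past_le hσ fun j hj => hwn j (hj.trans (hs.le.trans ht)))
        (hMW s)) hη)
  have herr := norm_sub_fixedState_le hγ0 hγ1 hK ha hσ (by positivity)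
    (x := ogdState A B K c η S M0 w) rfl ogdState_succ hMW hstep
    (fun j hj => hwn j (hj.trans ht))
  have hpast : ∀ k, past w t k ∈ supBall (Fin n) wbar := by
    intro k
    unfold past
    split
    · exact hw _ (by omega)
    · exact zero_mem_supBall hwbar
  obtain ⟨hx, hu⟩ := ((mem_Omega_iff A B K hwbar).1 (hMS t)).2 _ hpast
  set x := ogdState A B K c η S M0 w t with hxdef
  set r := x - fixedState A B K (past w t) (M t) with hr
  have hKn : specNorm K ≤ κ := by
    obtain ⟨-, -, -, -, -, hKn, -⟩ := hK
    exact hKn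
  -- One bound serves both constraints: the state is off by `r`, the input by $-Kr$, and
  -- $\|K\|_2\le\kappa$ with $\kappa>1$.
  have hκr : κ * ‖r‖ ≤ ε := by
    have h1 := truncation_error_le_eps1 (n := n) hH0 hκ hB hγ0 hγ1 hwbar
    have h2 := variation_error_le_eps2 (n := n) (m := m) (H := H) hκ hB hγ0 hγ1 hwbar hG hη
    calc κ * ‖r‖ ≤ κ * _ := mul_le_mul_of_nonneg_left herr (by positivity)
      _ ≤ _ := by rw [mul_add]; exact add_le_add h1 h2
      _ ≤ ε := hlower
  have hrn : ‖r‖ ≤ ε := (le_mul_of_one_le_left (norm_nonneg _) hκ.le).trans hκr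
  constructor
  · have := hx.2 r (mem_supBall_of_norm_le hrn)
    rwa [hr, add_sub_cancel] at this
  · have hin : ogdInput A B K c η S M0 w t
        = fixedInput A B K (past w t) (M t) + -act K r := by
      rw [ogdInput, dacInput_eq, fixedInput, hr, act_sub]
      abel
    rw [hin]
    refine hu.2 _ (mem_supBall_of_norm_le ?_)
    rw [norm_neg]
    exact (norm_act_le_of_le hKn le_rfl).trans hκr
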